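/- An \emph{affine surface} is a connected Hausdorff surface $\Sigma$ with a finite set $S\subset\Sigma$ and an atlas of $\mathbb{C}$-valued charts on $\Sigma\setminus S$ whose transition maps are locally of the form $z\mapsto az+b$ with $a\in\mathbb{R}_{>0}$, $b\in\mathbb{C}$, such that every point of $S$ has a punctured neighbourhood affinely equivalent to a punctured neighbourhood of the cone point of a Euclidean cone of angle $2\pi k$, $k\ge 1$. An \emph{affine automorphism} of $\Sigma$ is a homeomorphism $f$ of $\Sigma$ with $f(S)=S$ which, in the charts on $\Sigma\setminus S$, is locally given by elements of $\mathrm{GL}^+(2,\mathbb{R})\ltimes\mathbb{R}^2$ (with $\mathbb{C}\simeq\mathbb{R}^2$). Its linear part is well defined up to multiplication by a positive real number, and the \emph{Veech group} $\mathbf{V}_\Sigma\subset\mathrm{SL}(2,\mathbb{R})$ is the group of the linear parts of the affine automorphisms of $\Sigma$, normalised to have determinant $1$. Let $\Sigma$ be the \emph{Disco surface}: the affine surface obtained from the rectangle $[0,6]\times[0,1]$ by gluing the left side to the right side by the translation $z\mapsto z+6$, and by gluing the segments $[0,1]$, $[1,3]$, $[3,5]$, $[5,6]$ of the top side to the segments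 $[1,3]$, $[0,1]$, $[5,6]$, $[3,5]$ of the bottom side, respectively, by the maps $z\mapsto az+b$, $a>0$, that send one segment onto the other. Its set $S$ consists of the images of the vertices (the endpoints of all these segments), which are two points of cone angle $4\pi$. \textbf{Proposition.} The group $$\Gamma=\left\langle \begin{pmatrix}1&6\\0&1\end{pmatrix},\ \begin{pmatrix}1&0\\ \tfrac32&1\end{pmatrix},\ \begin{pmatrix}-1&0\\0&-1\end{pmatrix}\right\rangle$$ is a subgroup of the Veech group $\mathbf{V}_\Sigma$ of the Disco surface. -/

import Mathlib

open Topology Filter Set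

noncomputable section

/-- `F` is, near `x`, the composition of `G` with a map `z ↦ a z + b`, `a > 0` real. -/
def IsDilationAt {X : Type*} [TopologicalSpace X] (F G : X → ℂ) (x : X) : Prop :=
  ∃ a : ℝ, 0 < a ∧ ∃ b : ℂ, ∀ᶠ y in 𝓝 x, F y = a * G y + b

/-- An affine surface structure on the space `X`: a finite set of singularities and an atlas of
`ℂ`-valued charts on its complement, whose transition maps are locally of the form `z ↦ a z + b`
with `a > 0` real, such that each singularity is a cone point of angle a multiple of `2π`. -/
structure AffineSurface (X : Type*) [TopologicalSpace X] where
  t2 : T2Space X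
  connected : ConnectedSpace X
  sing : Set X
  sing_finite : sing.Finite
  atlas : Set (OpenPartialHomeomorph X ℂ)
  cover : ⋃ φ ∈ atlas, φ.source = singᶜ
  transition : ∀ φ ∈ atlas, ∀ ψ ∈ atlas, ∀ x ∈ φ.source ∩ ψ.source, IsDilationAt ψ φ x
  /-- The euclidean cone of angle `2πk` is `ℂ` with the affine structure given, away from the cone
  point `0`, by the local inverses of `w ↦ w ^ k`; so a punctured neighbourhood of `s` is affinely
  equivalent to a punctured neighbourhood of its cone point through `h`. -/
  cone : ∀ s ∈ sing, ∃ k : ℕ, 1 ≤ k ∧ ∃ h : OpenPartialHomeomorph X ℂ,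
    s ∈ h.source ∧ h s = 0 ∧ h.source ∩ sing = {s} ∧
    ∀ φ ∈ atlas, ∀ x ∈ h.source ∩ φ.source, IsDilationAt (fun y => h y ^ k) φ x

/-- The linear action of a real `2 × 2` matrix on `ℂ`, identified with `ℝ²`. -/
def matAct (A : Matrix (Fin 2) (Fin 2) ℝ) (z : ℂ) : ℂ :=
  ⟨A 0 0 * z.re + A 0 1 * z.im, A 1 0 * z.re + A 1 1 * z.im⟩

theorem matAct_mul (A B : Matrix (Fin 2) (Fin 2) ℝ) (z : ℂ) :
    matAct (A * B) z = matAct A (matAct B z) := by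
  apply Complex.ext <;> simp [matAct, Matrix.mul_apply, Fin.sum_univ_two] <;> ring

theorem matAct_one (z : ℂ) : matAct 1 z = z := by
  apply Complex.ext <;> simp [matAct]

theorem matAct_add (A : Matrix (Fin 2) (Fin 2) ℝ) (z w : ℂ) :
    matAct A (z + w) = matAct A z + matAct A w := by
  apply Complex.ext <;> simp [matAct] <;> ring

theorem matAct_real_mul (A : Matrix (Fin 2) (Fin 2) ℝ) (c : ℝ) (z : ℂ) :
    matAct A (c * z) = c * matAct A z := by
  apply Complex.ext <;> simp [matAct] <;> ring

theorem matAct_smul (A : Matrix (Fin 2) (Fin 2) ℝ) (c : ℝ) (z : ℂ) :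
    matAct (c • A) z = c * matAct A z := by
  apply Complex.ext <;> simp [matAct] <;> ring

namespace AffineSurface

variable {X : Type*} [TopologicalSpace X]

/-- Affine automorphisms: homeomorphisms that preserve the singularities and are given in
the charts, locally, by elements of `GL⁺(2, ℝ) ⋉ ℝ²`. -/
def IsAffineAut (S : AffineSurface X) (f : X ≃ₜ X) : Prop :=
  f '' S.sing = S.sing ∧
  ∀ φ ∈ S.atlas, ∀ ψ ∈ S.atlas, ∀ x ∈ φ.source, f x ∈ ψ.source →
    ∃ A : Matrix (Fin 2) (Fin 2) ℝ, 0 < A.det ∧ ∃ b : ℂ,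
      ∀ᶠ y in 𝓝 x, ψ (f y) = matAct A (φ y) + b

/-- The linear part of `f` in the charts is, up to positive scalars, the matrix `M` of
determinant one; that is, `M` is the normalised linear part of `f`. -/
def HasNormalizedLinearPart (S : AffineSurface X) (f : X ≃ₜ X)
    (M : Matrix.SpecialLinearGroup (Fin 2) ℝ) : Prop :=
  ∀ φ ∈ S.atlas, ∀ ψ ∈ S.atlas, ∀ x ∈ φ.source, f x ∈ ψ.source →
    ∃ c : ℝ, 0 < c ∧ ∃ b : ℂ, ∀ᶠ y in 𝓝 x, ψ (f y) = matAct (c • M.1) (φ y) + b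

theorem exists_chart (S : AffineSurface X) {x : X} (hx : x ∉ S.sing) :
    ∃ φ ∈ S.atlas, x ∈ φ.source := by
  have : x ∈ ⋃ φ ∈ S.atlas, φ.source := by rw [S.cover]; exact hx
  simpa using this

theorem notMem_sing (S : AffineSurface X) {φ : OpenPartialHomeomorph X ℂ} (hφ : φ ∈ S.atlas)
    {x : X} (hx : x ∈ φ.source) : x ∉ S.sing := by
  have : x ∈ ⋃ φ ∈ S.atlas, φ.source := by simpa using ⟨φ, hφ, hx⟩
  rwa [S.cover] at this

theorem HasNormalizedLinearPart.isAffineAut {S : AffineSurface X} {f : X ≃ₜ X}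
    {M : Matrix.SpecialLinearGroup (Fin 2) ℝ} (h : S.HasNormalizedLinearPart f M)
    (hs : f '' S.sing = S.sing) : S.IsAffineAut f := by
  refine ⟨hs, fun φ hφ ψ hψ x hx hfx => ?_⟩
  obtain ⟨c, hc, b, hb⟩ := h φ hφ ψ hψ x hx hfx
  refine ⟨c • M.1, ?_, b, hb⟩
  rw [Matrix.det_smul, M.2]
  simpa using pow_pos hc 2

/-- The Veech group: the group of normalised linear parts of the affine automorphisms. -/
def veechGroup (S : AffineSurface X) : Subgroup (Matrix.SpecialLinearGroup (Fin 2) ℝ) where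
  carrier := {M | ∃ f : X ≃ₜ X, S.IsAffineAut f ∧ S.HasNormalizedLinearPart f M}
  one_mem' := by
    have h : S.HasNormalizedLinearPart (Homeomorph.refl X) 1 := by
      intro φ hφ ψ hψ x hx hfx
      obtain ⟨a, ha, b, hb⟩ := S.transition φ hφ ψ hψ x ⟨hx, hfx⟩
      refine ⟨a, ha, b, hb.mono fun y hy => ?_⟩
      simp only [Homeomorph.refl_apply, matAct_smul, Matrix.SpecialLinearGroup.coe_one,
        matAct_one]
      exact hy
    exact ⟨_, h.isAffineAut (by simp), h⟩
  mul_mem' := by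
    rintro M N ⟨f, hf, hfM⟩ ⟨g, hg, hgN⟩
    have h : S.HasNormalizedLinearPart (g.trans f) (M * N) := by
      intro φ hφ ψ hψ x hx hfx
      have hgx : g x ∉ S.sing := by
        intro hgx
        rw [← hg.1] at hgx
        obtain ⟨x', hx', he⟩ := hgx
        exact S.notMem_sing hφ hx (g.injective he ▸ hx')
      obtain ⟨χ, hχ, hxχ⟩ := S.exists_chart hgx
      obtain ⟨c, hc, b, hb⟩ := hgN φ hφ χ hχ x hx hxχ
      obtain ⟨c', hc', b', hb'⟩ := hfM χ hχ ψ hψ (g x) hxχ hfx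
      refine ⟨c' * c, mul_pos hc' hc, c' * matAct M.1 b + b', ?_⟩
      filter_upwards [hb, g.continuous.continuousAt.eventually hb'] with y hy hy'
      simp only [Homeomorph.trans_apply]
      rw [hy', hy]
      simp only [Matrix.SpecialLinearGroup.coe_mul, matAct_smul, matAct_mul, matAct_add,
        matAct_real_mul]
      push_cast
      ring
    refine ⟨_, h.isAffineAut ?_, h⟩
    rw [show (⇑(g.trans f) : X → X) = f ∘ g from rfl, image_comp, hg.1, hf.1]
  inv_mem' := by
    rintro M ⟨f, hf, hfM⟩
    have h : S.HasNormalizedLinearPart f.symm M⁻¹ := by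
      intro φ hφ ψ hψ x hx hfx
      obtain ⟨c, hc, b, hb⟩ := hfM ψ hψ φ hφ (f.symm x) hfx (by simpa using hx)
      refine ⟨c⁻¹, inv_pos.2 hc, -(c⁻¹ * matAct (M⁻¹).1 b), ?_⟩
      filter_upwards [f.symm.continuous.continuousAt.eventually hb] with y hy
      rw [Homeomorph.apply_symm_apply] at hy
      have h1 : ∀ z, matAct (M⁻¹).1 (matAct M.1 z) = z := by
        intro z
        rw [← matAct_mul, ← Matrix.SpecialLinearGroup.coe_mul, inv_mul_cancel,
          Matrix.SpecialLinearGroup.coe_one, matAct_one]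
      have hc' : (c : ℂ) ≠ 0 := by exact_mod_cast hc.ne'
      rw [hy, matAct_smul, matAct_smul, matAct_add, matAct_real_mul, h1]
      push_cast
      field_simp
      ring
    refine ⟨_, h.isAffineAut ?_, h⟩
    conv_lhs => rw [← hf.1]
    rw [← image_comp]
    simp

end AffineSurface

namespace Disco

/-- The rectangle `[0, 6] × [0, 1]` in `ℂ = ℝ²`. -/
def polygon : Set ℂ := {z | (0 ≤ z.re ∧ z.re ≤ 6) ∧ 0 ≤ z.im ∧ z.im ≤ 1}

/-- The gluing of the sides of the rectangle: the left side is glued to the right side, and the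
segments `[0, 1]`, `[1, 3]`, `[3, 5]`, `[5, 6]` of the top side are glued to the segments `[1, 3]`,
`[0, 1]`, `[5, 6]`, `[3, 5]` of the bottom side, in this order, each by the orientation preserving
affine map. -/
def Glue (p q : polygon) : Prop :=
  (p.1.re = 0 ∧ q.1.re = 6 ∧ q.1.im = p.1.im) ∨
  (p.1.im = 1 ∧ q.1.im = 0 ∧
    ((0 ≤ p.1.re ∧ p.1.re ≤ 1 ∧ q.1.re = 2 * p.1.re + 1) ∨
     (1 ≤ p.1.re ∧ p.1.re ≤ 3 ∧ q.1.re = (p.1.re - 1) / 2) ∨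
     (3 ≤ p.1.re ∧ p.1.re ≤ 5 ∧ q.1.re = (p.1.re - 3) / 2 + 5) ∨
     (5 ≤ p.1.re ∧ p.1.re ≤ 6 ∧ q.1.re = 2 * (p.1.re - 5) + 3)))

/-- The underlying space of the Disco surface, with the quotient topology. -/
def Surface : Type := Quot Glue

instance : TopologicalSpace Surface := inferInstanceAs (TopologicalSpace (Quot Glue))

/-- The projection of the polygon onto the surface. -/
def proj (p : polygon) : Surface := Quot.mk Glue p

/-- The vertices of the polygon. -/
def IsVertex (p : polygon) : Prop :=
  (p.1.im = 0 ∨ p.1.im = 1) ∧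
    (p.1.re = 0 ∨ p.1.re = 1 ∨ p.1.re = 3 ∨ p.1.re = 5 ∨ p.1.re = 6)

/-- The singular points of the surface: the images of the vertices. -/
def sing : Set Surface := proj '' {p | IsVertex p}

theorem continuous_proj : Continuous proj := continuous_quot_mk

theorem surjective_proj : Function.Surjective proj := Quot.mk_surjective

/-- One class of vertices. -/
def V1 (p : polygon) : Prop :=
  (p.1.im = 1 ∧ (p.1.re = 0 ∨ p.1.re = 3 ∨ p.1.re = 6)) ∨
  (p.1.im = 0 ∧ (p.1.re = 1 ∨ p.1.re = 5))

/-- The other class of vertices. -/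
def V2 (p : polygon) : Prop :=
  (p.1.im = 0 ∧ (p.1.re = 0 ∨ p.1.re = 3 ∨ p.1.re = 6)) ∨
  (p.1.im = 1 ∧ (p.1.re = 1 ∨ p.1.re = 5))

theorem isVertex_iff (p : polygon) : IsVertex p ↔ V1 p ∨ V2 p := by
  unfold IsVertex V1 V2; tauto

/-- The equivalence relation generated by the gluing. -/
def Rel (p q : polygon) : Prop :=
  p = q ∨ (V1 p ∧ V1 q) ∨ (V2 p ∧ V2 q) ∨ Glue p q ∨ Glue q p

theorem ext' {p q : polygon} (h : p.1.re = q.1.re) (h' : p.1.im = q.1.im) : p = q :=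
  Subtype.ext (Complex.ext h h')

theorem glue_V1 {p q : polygon} (h : Glue p q) : V1 p ↔ V1 q := by
  obtain ⟨⟨x, y⟩, hp⟩ := p
  obtain ⟨⟨x', y'⟩, hq⟩ := q
  simp only [Glue, V1] at *
  grind

theorem glue_V2 {p q : polygon} (h : Glue p q) : V2 p ↔ V2 q := by
  obtain ⟨⟨x, y⟩, hp⟩ := p
  obtain ⟨⟨x', y'⟩, hq⟩ := q
  simp only [Glue, V2] at *
  grind

theorem glue_glue {p q r : polygon} (h : Glue p q) (h' : Glue q r) : V1 q ∨ V2 q := by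
  obtain ⟨⟨x, y⟩, hp⟩ := p
  obtain ⟨⟨x', y'⟩, hq⟩ := q
  obtain ⟨⟨x'', y''⟩, hr⟩ := r
  simp only [Glue, V1, V2] at *
  grind

theorem glue_right {p q r : polygon} (h : Glue p q) (h' : Glue p r) :
    q = r ∨ V1 p ∨ V2 p := by
  by_contra hc
  push Not at hc
  obtain ⟨h1, h2, h3⟩ := hc
  apply h1
  obtain ⟨⟨x, y⟩, hp⟩ := p
  obtain ⟨⟨x', y'⟩, hq⟩ := q
  obtain ⟨⟨x'', y''⟩, hr⟩ := r
  simp only [Glue, V1, V2, polygon] at *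
  apply ext' <;> dsimp only <;> grind

theorem glue_left {p q r : polygon} (h : Glue p r) (h' : Glue q r) :
    p = q ∨ V1 r ∨ V2 r := by
  by_contra hc
  push Not at hc
  obtain ⟨h1, h2, h3⟩ := hc
  apply h1
  obtain ⟨⟨x, y⟩, hp⟩ := p
  obtain ⟨⟨x', y'⟩, hq⟩ := q
  obtain ⟨⟨x'', y''⟩, hr⟩ := r
  simp only [Glue, V1, V2, polygon] at *
  apply ext' <;> dsimp only <;> grind

theorem Rel.symm {p q : polygon} (h : Rel p q) : Rel q p := by
  rcases h with h | h | h | h | h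
  · exact Or.inl h.symm
  · exact Or.inr (Or.inl h.symm)
  · exact Or.inr (Or.inr (Or.inl h.symm))
  · exact Or.inr (Or.inr (Or.inr (Or.inr h)))
  · exact Or.inr (Or.inr (Or.inr (Or.inl h)))

theorem Rel.V1_iff {p q : polygon} (h : Rel p q) (hp : V1 p ∨ V2 p) :
    (V1 p ∧ V1 q) ∨ (V2 p ∧ V2 q) := by
  rcases h with h | h | h | h | h
  · subst h; tauto
  · tauto
  · tauto
  · have := glue_V1 h; have := glue_V2 h; tauto
  · have := glue_V1 h; have := glue_V2 h; tauto

theorem not_V1_V2 {p : polygon} (h : V1 p) (h' : V2 p) : False := by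
  unfold V1 at h; unfold V2 at h'
  rcases h with ⟨a, b⟩ | ⟨a, b⟩ <;> rcases h' with ⟨c, d⟩ | ⟨c, d⟩
  · linarith
  · rcases b with b | b | b <;> rcases d with d | d <;> linarith
  · rcases b with b | b <;> rcases d with d | d | d <;> linarith
  · linarith

theorem Rel.trans {p q r : polygon} (h : Rel p q) (h' : Rel q r) : Rel p r := by
  by_cases hq : V1 q ∨ V2 q
  · have h1 := h'.V1_iff hq
    have h2 := h.symm.V1_iff hq
    have := not_V1_V2 (p := q)
    unfold Rel
    tauto
  · have hq1 : ¬ V1 q := fun hh => hq (Or.inl hh)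
    have hq2 : ¬ V2 q := fun hh => hq (Or.inr hh)
    rcases h with h | h | h | h | h
    · exact h ▸ h'
    · exact absurd h.2 hq1
    · exact absurd h.2 hq2
    · rcases h' with h' | h' | h' | h' | h'
      · exact h' ▸ Or.inr (Or.inr (Or.inr (Or.inl h)))
      · exact absurd h'.1 hq1
      · exact absurd h'.1 hq2
      · exact absurd (glue_glue h h') hq
      · exact Or.inl ((glue_left h h').resolve_right hq)
    · rcases h' with h' | h' | h' | h' | h'
      · exact h' ▸ Or.inr (Or.inr (Or.inr (Or.inr h)))
      · exact absurd h'.1 hq1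
      · exact absurd h'.1 hq2
      · exact Or.inl ((glue_right h h').resolve_right hq)
      · exact absurd (glue_glue h' h) hq

theorem mem_mk {x y : ℝ} (h : (0 ≤ x ∧ x ≤ 6) ∧ 0 ≤ y ∧ y ≤ 1) : (⟨x, y⟩ : ℂ) ∈ polygon := h

theorem proj_V1 {p : polygon} (h : V1 p) :
    proj p = proj ⟨⟨1, 0⟩, mem_mk (by norm_num)⟩ := by
  have h6 : proj ⟨⟨3, 1⟩, mem_mk (by norm_num)⟩ = proj ⟨⟨1, 0⟩, mem_mk (by norm_num)⟩ :=
    Quot.sound (by simp only [Glue]; norm_num)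
  have h5 : proj ⟨⟨3, 1⟩, mem_mk (by norm_num)⟩ = proj ⟨⟨5, 0⟩, mem_mk (by norm_num)⟩ :=
    Quot.sound (by simp only [Glue]; norm_num)
  have h4 : proj ⟨⟨0, 1⟩, mem_mk (by norm_num)⟩ = proj ⟨⟨1, 0⟩, mem_mk (by norm_num)⟩ :=
    Quot.sound (by simp only [Glue]; norm_num)
  have h3 : proj ⟨⟨6, 1⟩, mem_mk (by norm_num)⟩ = proj ⟨⟨5, 0⟩, mem_mk (by norm_num)⟩ :=
    Quot.sound (by simp only [Glue]; norm_num)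
  obtain ⟨⟨x, y⟩, hp⟩ := p
  simp only [V1] at h
  rcases h with ⟨rfl, rfl | rfl | rfl⟩ | ⟨rfl, rfl | rfl⟩
  · exact h4
  · exact h6
  · exact h3.trans (h5.symm.trans h6)
  · rfl
  · exact h5.symm.trans h6

theorem proj_V2 {p : polygon} (h : V2 p) :
    proj p = proj ⟨⟨0, 0⟩, mem_mk (by norm_num)⟩ := by
  have h6 : proj ⟨⟨0, 0⟩, mem_mk (by norm_num)⟩ = proj ⟨⟨6, 0⟩, mem_mk (by norm_num)⟩ :=
    Quot.sound (by simp only [Glue]; norm_num)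
  have h5 : proj ⟨⟨1, 1⟩, mem_mk (by norm_num)⟩ = proj ⟨⟨0, 0⟩, mem_mk (by norm_num)⟩ :=
    Quot.sound (by simp only [Glue]; norm_num)
  have h4 : proj ⟨⟨1, 1⟩, mem_mk (by norm_num)⟩ = proj ⟨⟨3, 0⟩, mem_mk (by norm_num)⟩ :=
    Quot.sound (by simp only [Glue]; norm_num)
  have h3 : proj ⟨⟨5, 1⟩, mem_mk (by norm_num)⟩ = proj ⟨⟨3, 0⟩, mem_mk (by norm_num)⟩ :=
    Quot.sound (by simp only [Glue]; norm_num)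
  obtain ⟨⟨x, y⟩, hp⟩ := p
  simp only [V2] at h
  rcases h with ⟨rfl, rfl | rfl | rfl⟩ | ⟨rfl, rfl | rfl⟩
  · rfl
  · exact h4.symm.trans h5
  · exact h6.symm
  · exact h5
  · exact h3.trans (h4.symm.trans h5)

theorem proj_eq_iff {p q : polygon} : proj p = proj q ↔ Rel p q := by
  constructor
  · intro h
    have h' := Quot.eqvGen_exact h
    clear h
    induction h' with
    | rel x y h => exact Or.inr (Or.inr (Or.inr (Or.inl h)))
    | refl x => exact Or.inl rfl
    | symm x y _ ih => exact ih.symm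
    | trans x y z _ _ ih1 ih2 => exact ih1.trans ih2
  · rintro (h | ⟨h1, h2⟩ | ⟨h1, h2⟩ | h | h)
    · rw [h]
    · rw [proj_V1 h1, proj_V1 h2]
    · rw [proj_V2 h1, proj_V2 h2]
    · exact Quot.sound h
    · exact (Quot.sound h).symm

theorem proj_mem_sing {p : polygon} : proj p ∈ sing ↔ IsVertex p := by
  constructor
  · rintro ⟨q, hq, h⟩
    have h1 := (proj_eq_iff.1 h).V1_iff ((isVertex_iff q).1 hq)
    rw [isVertex_iff]
    tauto
  · intro h
    exact ⟨p, h, rfl⟩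

theorem isCompact_polygon : IsCompact polygon := by
  have : polygon = Icc (0 : ℝ) 6 ×ℂ Icc (0 : ℝ) 1 := by
    ext z; simp [polygon, Complex.mem_reProdIm]
  rw [this]
  exact isCompact_Icc.reProdIm isCompact_Icc

instance : CompactSpace polygon := isCompact_iff_compactSpace.1 isCompact_polygon

instance : CompactSpace Surface := inferInstanceAs (CompactSpace (Quot Glue))

instance : ConnectedSpace polygon := by
  rw [← isConnected_iff_connectedSpace]
  refine ⟨⟨0, by simp [polygon]⟩, Convex.isPreconnected ?_⟩
  rintro x ⟨⟨h1, h2⟩, h3, h4⟩ y ⟨⟨h5, h6⟩, h7, h8⟩ a b ha hb hab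
  refine ⟨⟨?_, ?_⟩, ?_, ?_⟩ <;> simp <;> nlinarith

instance : ConnectedSpace Surface := surjective_proj.connectedSpace continuous_proj

theorem isClosed_rel : IsClosed {x : polygon × polygon | Rel x.1 x.2} := by
  unfold Rel Glue V1 V2
  have c1 : Continuous fun x : polygon × polygon => x.1.1.re := by fun_prop
  have c2 : Continuous fun x : polygon × polygon => x.1.1.im := by fun_prop
  have c3 : Continuous fun x : polygon × polygon => x.2.1.re := by fun_prop
  have c4 : Continuous fun x : polygon × polygon => x.2.1.im := by fun_prop
  simp only [ofPred_or, ofPred_and]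
  repeat' first
    | apply IsClosed.union
    | apply IsClosed.inter
    | (apply isClosed_le <;> fun_prop)
    | (apply isClosed_eq <;> fun_prop)

theorem isClosedMap_proj : IsClosedMap proj := by
  intro C hC
  have hq : IsQuotientMap proj := isQuotientMap_quot_mk
  rw [← hq.isClosed_preimage]
  have : proj ⁻¹' (proj '' C) =
      Prod.snd '' ({x : polygon × polygon | Rel x.1 x.2} ∩ Prod.fst ⁻¹' C) := by
    ext p
    constructor
    · rintro ⟨q, hq, h⟩
      exact ⟨(q, p), ⟨proj_eq_iff.1 h, hq⟩, rfl⟩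
    · rintro ⟨⟨q, p'⟩, ⟨h, hq⟩, rfl⟩
      exact ⟨q, hq, proj_eq_iff.2 h⟩
  rw [this]
  exact ((isClosed_rel.inter (hC.preimage continuous_fst)).isCompact.image
    continuous_snd).isClosed

theorem isProperMap_proj : IsProperMap proj := by
  rw [isProperMap_iff_isClosedMap_and_compact_fibers]
  refine ⟨continuous_proj, isClosedMap_proj, fun y => ?_⟩
  obtain ⟨p, rfl⟩ := surjective_proj y
  have : proj ⁻¹' {proj p} = (fun q => (p, q)) ⁻¹' {x : polygon × polygon | Rel x.1 x.2} := by
    ext q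
    simp only [mem_preimage, mem_singleton_iff, mem_ofPred_eq, ← proj_eq_iff]
    exact eq_comm
  rw [this]
  exact (isClosed_rel.preimage (by fun_prop)).isCompact

instance : T2Space Surface := by
  rw [t2_iff_isClosed_diagonal]
  have h := (isProperMap_proj.prodMap isProperMap_proj).isClosedMap _ isClosed_rel
  convert h
  ext ⟨x, y⟩
  obtain ⟨p, rfl⟩ := surjective_proj x
  obtain ⟨q, rfl⟩ := surjective_proj y
  simp only [mem_diagonal_iff, mem_image, mem_ofPred_eq, Prod.exists, Prod.map_apply,
    Prod.mk.injEq]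
  constructor
  · intro h
    exact ⟨p, q, proj_eq_iff.1 h, rfl, rfl⟩
  · rintro ⟨p', q', h, h1, h2⟩
    rw [← h1, ← h2, proj_eq_iff.2 h]

theorem eventually_nhds_proj {Q : Surface → Prop} {x : Surface}
    (h : ∀ p, proj p = x → ∀ᶠ p' in 𝓝 p, Q (proj p')) : ∀ᶠ y in 𝓝 x, Q y := by
  have := isClosedMap_proj.eventually_nhds_fiber (p := fun p => Q (proj p)) x
    (fun p hp => h p hp)
  filter_upwards [this] with y hy
  obtain ⟨p, rfl⟩ := surjective_proj y
  exact hy p rfl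

theorem sing_finite : sing.Finite := by
  refine Set.Finite.subset (Set.toFinite {proj ⟨⟨1, 0⟩, mem_mk (by norm_num)⟩,
    proj ⟨⟨0, 0⟩, mem_mk (by norm_num)⟩}) ?_
  rintro _ ⟨p, hp, rfl⟩
  rcases (isVertex_iff p).1 hp with h | h
  · exact Or.inl (proj_V1 h)
  · exact Or.inr (proj_V2 h)

/-- The nearest point of the polygon. -/
def clamp (z : ℂ) : polygon :=
  ⟨⟨max 0 (min 6 z.re), max 0 (min 1 z.im)⟩, by
    refine ⟨⟨?_, ?_⟩, ?_, ?_⟩ <;> simp⟩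

theorem clamp_of_mem {z : ℂ} (hz : z ∈ polygon) : clamp z = ⟨z, hz⟩ := by
  obtain ⟨⟨h1, h2⟩, h3, h4⟩ := hz
  apply ext' <;> simp [clamp, *]

theorem clamp_coe (p : polygon) : clamp p.1 = p := clamp_of_mem p.2

theorem continuous_clamp : Continuous clamp := by
  refine Continuous.subtype_mk ?_ _
  have : (fun z : ℂ => (⟨max 0 (min 6 z.re), max 0 (min 1 z.im)⟩ : ℂ)) =
      fun z => Complex.equivRealProdCLM.symm (max 0 (min 6 z.re), max 0 (min 1 z.im)) := by
    ext z; simp [Complex.ext_iff]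
  rw [this]
  fun_prop

/-- Pieces of the polygon, with continuous maps to pieces of an open set of `ℂ`, that fit together
to a chart of the surface. -/
structure Pieces (ι : Type) where
  W : ι → Set ℂ
  D : ι → ℂ → ℂ
  s : ι → ℂ → ℂ
  C : ι → Set ℂ
  U : Set ℂ
  isOpen_W : ∀ i, IsOpen (W i)
  isOpen_U : IsOpen U
  isClosed_C : ∀ i, IsClosed (C i)
  cover : ∀ u ∈ U, ∃ i, u ∈ C i
  continuous_D : ∀ i, Continuous (D i)
  continuous_s : ∀ i, Continuous (s i)
  D_mem : ∀ i, ∀ z ∈ polygon, z ∈ W i → D i z ∈ U ∧ D i z ∈ C i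
  s_mem : ∀ i, ∀ u ∈ U, u ∈ C i → s i u ∈ polygon ∧ s i u ∈ W i
  D_s : ∀ i, ∀ u ∈ U, u ∈ C i → D i (s i u) = u
  s_D : ∀ i, ∀ z ∈ polygon, z ∈ W i → s i (D i z) = z
  disj : ∀ i j, ∀ z ∈ polygon, z ∈ W i → z ∈ W j → i = j
  glue : ∀ p q : polygon, Glue p q → ∀ i, p.1 ∈ W i → ∃ j, q.1 ∈ W j ∧ D j q.1 = D i p.1
  glue' : ∀ p q : polygon, Glue p q → ∀ i, q.1 ∈ W i → ∃ j, p.1 ∈ W j ∧ D j p.1 = D i q.1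
  same : ∀ i j, ∀ u ∈ U, u ∈ C i → u ∈ C j → Rel (clamp (s i u)) (clamp (s j u))

namespace Pieces

variable {ι : Type} (P : Pieces ι)

open Classical in
/-- The chart on the polygon. -/
def fwd (p : polygon) : ℂ := if h : ∃ i, p.1 ∈ P.W i then P.D h.choose p.1 else 0

theorem fwd_eq {p : polygon} {i : ι} (h : p.1 ∈ P.W i) : P.fwd p = P.D i p.1 := by
  have h' : ∃ i, p.1 ∈ P.W i := ⟨i, h⟩
  rw [fwd, dif_pos h', P.disj _ _ _ p.2 h'.choose_spec h]

theorem fwd_glue (p q : polygon) (h : Glue p q) : P.fwd p = P.fwd q := by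
  by_cases hp : ∃ i, p.1 ∈ P.W i
  · obtain ⟨i, hi⟩ := hp
    obtain ⟨j, hj, e⟩ := P.glue p q h i hi
    rw [P.fwd_eq hi, P.fwd_eq hj, e]
  · have hq : ¬ ∃ i, q.1 ∈ P.W i := by
      rintro ⟨i, hi⟩
      obtain ⟨j, hj, _⟩ := P.glue' p q h i hi
      exact hp ⟨j, hj⟩
    rw [fwd, fwd, dif_neg hp, dif_neg hq]

/-- The chart on the surface. -/
def toFun : Surface → ℂ := Quot.lift P.fwd P.fwd_glue

theorem toFun_proj {p : polygon} {i : ι} (h : p.1 ∈ P.W i) : P.toFun (proj p) = P.D i p.1 :=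
  P.fwd_eq h

/-- The domain of the chart. -/
def source : Set Surface := {x | Quot.lift (fun p : polygon => ∃ i, p.1 ∈ P.W i) (by
  intro p q h
  apply propext
  constructor
  · rintro ⟨i, hi⟩
    obtain ⟨j, hj, _⟩ := P.glue p q h i hi
    exact ⟨j, hj⟩
  · rintro ⟨i, hi⟩
    obtain ⟨j, hj, _⟩ := P.glue' p q h i hi
    exact ⟨j, hj⟩) x}

theorem proj_mem_source {p : polygon} : proj p ∈ P.source ↔ ∃ i, p.1 ∈ P.W i := Iff.rfl

open Classical in
/-- The inverse of the chart. -/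
def invFun (u : ℂ) : Surface :=
  if h : ∃ i, u ∈ P.C i then proj (clamp (P.s h.choose u)) else proj (clamp 0)

theorem invFun_eq {u : ℂ} (hu : u ∈ P.U) {i : ι} (h : u ∈ P.C i) :
    P.invFun u = proj (clamp (P.s i u)) := by
  have h' : ∃ i, u ∈ P.C i := ⟨i, h⟩
  rw [invFun, dif_pos h']
  exact proj_eq_iff.2 (P.same _ _ u hu h'.choose_spec h)

theorem isOpen_source : IsOpen P.source := by
  have hq : IsQuotientMap proj := isQuotientMap_quot_mk
  rw [← hq.isOpen_preimage]
  have : proj ⁻¹' P.source = ⋃ i, Subtype.val ⁻¹' P.W i := by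
    ext p; simp [proj_mem_source]
  rw [this]
  exact isOpen_iUnion fun i => (P.isOpen_W i).preimage continuous_subtype_val

theorem continuousOn_toFun : ContinuousOn P.toFun P.source := by
  rw [P.isOpen_source.continuousOn_iff]
  intro x hx
  rw [ContinuousAt, Filter.tendsto_def]
  intro V hV
  apply eventually_nhds_proj (Q := fun y => P.toFun y ∈ V)
  rintro p rfl
  obtain ⟨i, hi⟩ := hx
  rw [P.toFun_proj hi] at hV
  have h1 : ∀ᶠ p' : polygon in 𝓝 p, p'.1 ∈ P.W i :=
    continuous_subtype_val.continuousAt.eventually ((P.isOpen_W i).mem_nhds hi)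
  have h2 : ∀ᶠ p' : polygon in 𝓝 p, P.D i p'.1 ∈ V :=
    ((P.continuous_D i).comp continuous_subtype_val).continuousAt.eventually hV
  filter_upwards [h1, h2] with p' h1 h2
  rwa [P.toFun_proj h1]

theorem continuousOn_invFun [Finite ι] : ContinuousOn P.invFun P.U := by
  intro u hu
  have key : ∀ i, ContinuousWithinAt P.invFun (P.U ∩ P.C i) u := by
    intro i
    by_cases h : u ∈ P.C i
    · have : ContinuousWithinAt (fun u => proj (clamp (P.s i u))) (P.U ∩ P.C i) u :=
        ((continuous_proj.comp (continuous_clamp.comp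
          (P.continuous_s i))).continuousWithinAt)
      exact this.congr (fun v hv => P.invFun_eq hv.1 hv.2) (P.invFun_eq hu h)
    · apply continuousWithinAt_of_notMem_closure
      intro h'
      exact h ((P.isClosed_C i).closure_subset (closure_mono inter_subset_right h'))
  have h2 : ContinuousWithinAt P.invFun (⋃ i, P.U ∩ P.C i) u := by
    rw [ContinuousWithinAt, nhdsWithin_iUnion]
    exact tendsto_iSup.2 key
  refine h2.mono fun v hv => ?_
  obtain ⟨i, hi⟩ := P.cover v hv
  exact mem_iUnion.2 ⟨i, hv, hi⟩

/-- The chart of the surface given by the pieces. -/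
def chart [Finite ι] : OpenPartialHomeomorph Surface ℂ where
  toFun := P.toFun
  invFun := P.invFun
  source := P.source
  target := P.U
  map_source' := by
    intro x hx
    obtain ⟨p, rfl⟩ := surjective_proj x
    obtain ⟨i, hi⟩ := hx
    rw [P.toFun_proj hi]
    exact (P.D_mem i _ p.2 hi).1
  map_target' := by
    intro u hu
    obtain ⟨i, hi⟩ := P.cover u hu
    obtain ⟨h1, h2⟩ := P.s_mem i u hu hi
    rw [P.invFun_eq hu hi, clamp_of_mem h1]
    exact ⟨i, h2⟩
  left_inv' := by
    intro x hx
    obtain ⟨p, rfl⟩ := surjective_proj x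
    obtain ⟨i, hi⟩ := hx
    obtain ⟨h1, h2⟩ := P.D_mem i _ p.2 hi
    rw [P.toFun_proj hi, P.invFun_eq h1 h2, P.s_D i _ p.2 hi, clamp_coe]
  right_inv' := by
    intro u hu
    obtain ⟨i, hi⟩ := P.cover u hu
    obtain ⟨h1, h2⟩ := P.s_mem i u hu hi
    rw [P.invFun_eq hu hi, clamp_of_mem h1, P.toFun_proj (i := i) h2, P.D_s i u hu hi]
  open_source := P.isOpen_source
  open_target := P.isOpen_U
  continuousOn_toFun := P.continuousOn_toFun
  continuousOn_invFun := P.continuousOn_invFun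

end Pieces

/-- Near `p`, the function `F` reads `z ↦ a z + b` on the polygon, with `a > 0` real. -/
def PolyDil (F : Surface → ℂ) (p : polygon) : Prop :=
  ∃ a : ℝ, 0 < a ∧ ∃ b : ℂ, ∀ᶠ p' : polygon in 𝓝 p, F (proj p') = a * p'.1 + b

theorem glue_near {p q : polygon} (h : Glue p q) (hp : ¬ IsVertex p) :
    ∃ v w : ℂ, v ≠ 0 ∧ ∀ᶠ t : ℝ in 𝓝 0,
      p.1 + t * v ∈ polygon ∧ Glue (clamp (p.1 + t * v)) (clamp (q.1 + t * w)) := by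
  obtain ⟨⟨x, y⟩, hx⟩ := p
  obtain ⟨⟨x', y'⟩, hx'⟩ := q
  have hmem : ∀ a b : ℝ, (⟨a, b⟩ : ℂ) ∈ polygon ↔ (0 ≤ a ∧ a ≤ 6) ∧ 0 ≤ b ∧ b ≤ 1 :=
    fun a b => Iff.rfl
  rw [hmem] at hx hx'
  simp only [IsVertex, not_and, not_or] at hp
  simp only [Glue] at h
  have hor : ∀ l : ℝ, ∀ z z' : ℝ,
      (⟨z, z'⟩ : ℂ) + (l : ℂ) * Complex.I = ⟨z, z' + l⟩ := by
    intro l z z'; apply Complex.ext <;> simp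
  have ver : ∀ l m : ℝ, ∀ z z' : ℝ,
      (⟨z, z'⟩ : ℂ) + (l : ℂ) * (m : ℂ) = ⟨z + l * m, z'⟩ := by
    intro l m z z'; apply Complex.ext <;> simp
  rcases h with ⟨rfl, rfl, rfl⟩ | ⟨rfl, rfl, h⟩
  · have h0 : y' ≠ 0 := by intro h; exact (hp (Or.inl h)).1 rfl
    have h1 : y' ≠ 1 := by intro h; exact (hp (Or.inr h)).1 rfl
    have h0' : 0 < y' := lt_of_le_of_ne hx.2.1 (Ne.symm h0)
    have h1' : y' < 1 := lt_of_le_of_ne hx.2.2 h1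
    refine ⟨Complex.I, Complex.I, Complex.I_ne_zero, ?_⟩
    filter_upwards [Ioo_mem_nhds (neg_neg_of_pos h0') (sub_pos.2 h1')] with t ht
    obtain ⟨h1, h2⟩ := ht
    have m1 : (⟨0, y' + t⟩ : ℂ) ∈ polygon :=
      (hmem _ _).2 ⟨by norm_num, by linarith, by linarith⟩
    have m2 : (⟨6, y' + t⟩ : ℂ) ∈ polygon :=
      (hmem _ _).2 ⟨by norm_num, by linarith, by linarith⟩
    rw [hor, hor, clamp_of_mem m1, clamp_of_mem m2]
    exact ⟨m1, by simp [Glue]⟩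
  · obtain ⟨n0, n1, n3, n5, n6⟩ := hp (Or.inr rfl)
    have key : ∃ m α β : ℝ, α < x ∧ x < β ∧ ∀ t, α < x + t → x + t < β →
        ((0 ≤ x + t ∧ x + t ≤ 6) ∧ (0 ≤ x' + t * m ∧ x' + t * m ≤ 6)) ∧
        ((0 ≤ x + t ∧ x + t ≤ 1 ∧ x' + t * m = 2 * (x + t) + 1) ∨
         (1 ≤ x + t ∧ x + t ≤ 3 ∧ x' + t * m = ((x + t) - 1) / 2) ∨
         (3 ≤ x + t ∧ x + t ≤ 5 ∧ x' + t * m = ((x + t) - 3) / 2 + 5) ∨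
         (5 ≤ x + t ∧ x + t ≤ 6 ∧ x' + t * m = 2 * ((x + t) - 5) + 3)) := by
      rcases h with h | h | h | h
      · exact ⟨2, 0, 1, by grind, by grind, fun t h1 h2 => by grind⟩
      · exact ⟨1 / 2, 1, 3, by grind, by grind, fun t h1 h2 => by grind⟩
      · exact ⟨1 / 2, 3, 5, by grind, by grind, fun t h1 h2 => by grind⟩
      · exact ⟨2, 5, 6, by grind, by grind, fun t h1 h2 => by grind⟩
    obtain ⟨m, α, β, hα, hβ, hk⟩ := key
    refine ⟨((1 : ℝ) : ℂ), (m : ℂ), by simp, ?_⟩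
    filter_upwards [Ioo_mem_nhds (sub_neg.2 hα) (sub_pos.2 hβ)] with t ht
    obtain ⟨hm, hg⟩ := hk t (by linarith [ht.1]) (by linarith [ht.2])
    rw [ver, ver, mul_one, clamp_of_mem ((hmem _ _).2 ⟨hm.1, by norm_num⟩),
      clamp_of_mem ((hmem _ _).2 ⟨hm.2, by norm_num⟩)]
    exact ⟨(hmem _ _).2 ⟨hm.1, by norm_num⟩, Or.inr ⟨rfl, rfl, hg⟩⟩

theorem ratio_eq {F G : Surface → ℂ} {p q : polygon} (h : Glue p q) (hp : ¬ IsVertex p)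
    {a a' : ℝ} {b b' : ℂ}
    (h1 : ∀ᶠ p' : polygon in 𝓝 p, F (proj p') = a * G (proj p') + b)
    (h2 : ∀ᶠ p' : polygon in 𝓝 q, F (proj p') = a' * G (proj p') + b')
    (hG : PolyDil G p) : a = a' ∧ b = b' := by
  obtain ⟨v, w, hv, ht⟩ := glue_near h hp
  obtain ⟨c, hc, d, hd⟩ := hG
  have c1 : Tendsto (fun t : ℝ => clamp (p.1 + t * v)) (𝓝 0) (𝓝 p) := by
    have : Continuous (fun t : ℝ => clamp (p.1 + t * v)) :=
      continuous_clamp.comp (by fun_prop)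
    have h := this.tendsto 0
    simpa [clamp_coe] using h
  have c2 : Tendsto (fun t : ℝ => clamp (q.1 + t * w)) (𝓝 0) (𝓝 q) := by
    have : Continuous (fun t : ℝ => clamp (q.1 + t * w)) :=
      continuous_clamp.comp (by fun_prop)
    have h := this.tendsto 0
    simpa [clamp_coe] using h
  have c3 : Tendsto (fun t : ℝ => p.1 + t * v) (𝓝 0) (𝓝 p.1) := by
    have : Continuous (fun t : ℝ => p.1 + t * v) := by fun_prop
    simpa using this.tendsto 0
  have key : ∀ᶠ t : ℝ in 𝓝 0,
      ((a : ℂ) - a') * G (proj (clamp (p.1 + t * v))) + (b - b') = 0 := by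
    filter_upwards [ht, c1.eventually h1, c2.eventually h2] with t ht e1 e2
    have e : proj (clamp (p.1 + t * v)) = proj (clamp (q.1 + t * w)) := Quot.sound ht.2
    rw [← e] at e2
    linear_combination e2 - e1
  have hG0 : G (proj p) = c * p.1 + d := hd.self_of_nhds
  have k0 := key.self_of_nhds
  have key2 : ∃ t : ℝ, t ≠ 0 ∧ ((a : ℂ) - a') * G (proj (clamp (p.1 + t * v))) + (b - b') = 0 ∧
      G (proj (clamp (p.1 + t * v))) ≠ G (proj p) := by
    have hinj : ∀ᶠ t : ℝ in 𝓝[≠] 0, G (proj (clamp (p.1 + t * v))) ≠ G (proj p) := by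
      filter_upwards [eventually_mem_nhdsWithin, ht.filter_mono nhdsWithin_le_nhds,
        (c1.eventually hd).filter_mono nhdsWithin_le_nhds] with t h0 hm he
      rw [he, hG0, clamp_of_mem hm.1]
      intro hh
      have h4 : (c : ℂ) * (t * v) = 0 := by linear_combination hh
      have h5 : (t : ℂ) ≠ 0 := by exact_mod_cast h0
      have h6 : (c : ℂ) ≠ 0 := by exact_mod_cast hc.ne'
      exact mul_ne_zero h6 (mul_ne_zero h5 hv) h4
    have h3 : ∀ᶠ t : ℝ in 𝓝[≠] 0, t ≠ 0 := eventually_mem_nhdsWithin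
    obtain ⟨t, h⟩ := (h3.and ((key.filter_mono nhdsWithin_le_nhds).and hinj)).exists
    exact ⟨t, h.1, h.2.1, h.2.2⟩
  obtain ⟨t, _, k1, k2⟩ := key2
  rw [Complex.ofReal_zero, zero_mul, add_zero, clamp_coe] at k0
  have : ((a : ℂ) - a') * (G (proj (clamp (p.1 + t * v))) - G (proj p)) = 0 := by
    linear_combination k1 - k0
  have haa : (a : ℂ) - a' = 0 := (mul_eq_zero.1 this).resolve_right (sub_ne_zero.2 k2)
  refine ⟨by exact_mod_cast sub_eq_zero.1 haa, ?_⟩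
  rw [haa, zero_mul, zero_add] at k0
  exact sub_eq_zero.1 k0

theorem PolyDil.ratio {F G : Surface → ℂ} {p : polygon} (hF : PolyDil F p) (hG : PolyDil G p) :
    ∃ a : ℝ, 0 < a ∧ ∃ b : ℂ, ∀ᶠ p' : polygon in 𝓝 p, F (proj p') = a * G (proj p') + b := by
  obtain ⟨a, ha, b, h⟩ := hF
  obtain ⟨c, hc, d, h'⟩ := hG
  refine ⟨a / c, div_pos ha hc, b - a / c * d, ?_⟩
  filter_upwards [h, h'] with p' h h'
  have h6 : (c : ℂ) ≠ 0 := by exact_mod_cast hc.ne'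
  rw [h, h']
  push_cast
  field_simp
  ring

theorem isDilationAt_of_polyDil {F G : Surface → ℂ} {x : Surface} (hx : x ∉ sing)
    (hF : ∀ p, proj p = x → PolyDil F p) (hG : ∀ p, proj p = x → PolyDil G p) :
    IsDilationAt F G x := by
  obtain ⟨p, rfl⟩ := surjective_proj x
  obtain ⟨a, ha, b, hab⟩ := (hF p rfl).ratio (hG p rfl)
  refine ⟨a, ha, b, eventually_nhds_proj (Q := fun y => F y = a * G y + b) fun q hq => ?_⟩
  obtain ⟨a', ha', b', hab'⟩ := (hF q hq).ratio (hG q hq)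
  have hpv : ¬ IsVertex p := fun h => hx (proj_mem_sing.2 h)
  have hqv : ¬ IsVertex q := fun h => hx (hq ▸ proj_mem_sing.2 h)
  have hpv' := mt (isVertex_iff p).2 hpv
  rcases proj_eq_iff.1 hq.symm with h | h | h | h | h
  · exact h ▸ hab
  · exact absurd (Or.inl h.1) hpv'
  · exact absurd (Or.inr h.1) hpv'
  · obtain ⟨rfl, rfl⟩ := ratio_eq h hpv hab hab' (hG p rfl)
    exact hab'
  · obtain ⟨rfl, rfl⟩ := ratio_eq h hqv hab' hab (hG q hq)
    exact hab'

theorem Pieces.polyDil {ι : Type} [Finite ι] (P : Pieces ι)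
    (h : ∀ i, ∃ a : ℝ, 0 < a ∧ ∃ b : ℂ, ∀ z ∈ P.W i, P.D i z = a * z + b)
    {p : polygon} (hp : proj p ∈ P.chart.source) : PolyDil P.chart p := by
  obtain ⟨i, hi⟩ := hp
  obtain ⟨a, ha, b, hab⟩ := h i
  refine ⟨a, ha, b, ?_⟩
  filter_upwards [continuous_subtype_val.continuousAt.eventually ((P.isOpen_W i).mem_nhds hi)]
    with p' hp'
  rw [← hab _ hp']
  exact P.toFun_proj hp'

/-- The interior of the rectangle. -/
def interiorPieces : Pieces Unit where
  W _ := {z | (0 < z.re ∧ z.re < 6) ∧ 0 < z.im ∧ z.im < 1}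
  D _ z := z
  s _ z := z
  C _ := univ
  U := {z | (0 < z.re ∧ z.re < 6) ∧ 0 < z.im ∧ z.im < 1}
  isOpen_W _ := by
    simp only [ofPred_and]
    repeat' first | apply IsOpen.inter | (apply isOpen_lt <;> fun_prop)
  isOpen_U := by
    simp only [ofPred_and]
    repeat' first | apply IsOpen.inter | (apply isOpen_lt <;> fun_prop)
  isClosed_C _ := isClosed_univ
  cover _ _ := ⟨(), trivial⟩
  continuous_D _ := continuous_id
  continuous_s _ := continuous_id
  D_mem _ z _ h := ⟨h, trivial⟩
  s_mem _ u h _ := ⟨⟨⟨h.1.1.le, h.1.2.le⟩, h.2.1.le, h.2.2.le⟩, h⟩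
  D_s _ _ _ _ := rfl
  s_D _ _ _ _ := rfl
  disj _ _ _ _ _ _ := rfl
  glue := by
    intro p q h i hi
    simp only [Glue, mem_ofPred_eq] at *
    grind
  glue' := by
    intro p q h i hi
    simp only [Glue, mem_ofPred_eq] at *
    grind
  same _ _ _ _ _ _ := Or.inl rfl

/-- A neighbourhood of the left and right sides of the rectangle. -/
def lateralPieces : Pieces Bool where
  W := fun
    | false => {z | z.re < 1 ∧ 0 < z.im ∧ z.im < 1}
    | true => {z | 5 < z.re ∧ 0 < z.im ∧ z.im < 1}
  D := fun
    | false => fun z => z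
    | true => fun z => z - 6
  s := fun
    | false => fun z => z
    | true => fun z => z + 6
  C := fun
    | false => {z | 0 ≤ z.re}
    | true => {z | z.re ≤ 0}
  U := {z | (-1 < z.re ∧ z.re < 1) ∧ 0 < z.im ∧ z.im < 1}
  isOpen_W := by
    rintro (_ | _) <;> simp only [ofPred_and] <;>
    repeat' first | apply IsOpen.inter | (apply isOpen_lt <;> fun_prop)
  isOpen_U := by
    simp only [ofPred_and]
    repeat' first | apply IsOpen.inter | (apply isOpen_lt <;> fun_prop)
  isClosed_C := by
    rintro (_ | _) <;> dsimp only <;> apply isClosed_le <;> fun_prop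
  cover := by
    intro u _
    rcases le_total 0 u.re with h | h
    · exact ⟨false, h⟩
    · exact ⟨true, h⟩
  continuous_D := by rintro (_ | _) <;> dsimp only <;> fun_prop
  continuous_s := by rintro (_ | _) <;> dsimp only <;> fun_prop
  D_mem := by
    rintro (_ | _) z hz hW <;> simp [polygon] at * <;> grind
  s_mem := by
    rintro (_ | _) z hz hW <;> simp [polygon] at * <;> grind
  D_s := by rintro (_ | _) <;> simp
  s_D := by rintro (_ | _) <;> simp
  disj := by
    rintro (_ | _) (_ | _) <;> simp <;> grind
  glue := by
    rintro ⟨⟨x, y⟩, hp⟩ ⟨⟨x', y'⟩, hq⟩ h (_ | _) hi <;>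
    simp [Glue, Complex.ext_iff] at * <;> grind
  glue' := by
    rintro ⟨⟨x, y⟩, hp⟩ ⟨⟨x', y'⟩, hq⟩ h (_ | _) hi <;>
    simp [Glue, Complex.ext_iff] at * <;> grind
  same := by
    have key : ∀ u : ℂ, 0 < u.im → u.im < 1 → u.re = 0 → Glue (clamp u) (clamp (u + 6)) := by
      intro u h1 h2 h3
      rw [clamp_of_mem (z := u) (by simp [polygon]; grind),
        clamp_of_mem (z := u + 6) (by simp [polygon]; grind)]
      simp [Glue, h3]
    rintro (_ | _) (_ | _) u hu hi hj
    · exact Or.inl rfl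
    · exact Or.inr (Or.inr (Or.inr (Or.inl (key u hu.2.1 hu.2.2 (le_antisymm hj hi)))))
    · exact Or.inr (Or.inr (Or.inr (Or.inr (key u hu.2.1 hu.2.2 (le_antisymm hi hj)))))
    · exact Or.inl rfl

/-- A neighbourhood of the interior of the segment `[α, β]` of the top side, glued to the segment
`[α', β']` of the bottom side. -/
def edgePieces (α β α' β' l r : ℝ) (hr : 0 < r) (hlr : l * r = 1)
    (hl : β' - α' = l * (β - α)) (h0 : 0 ≤ α) (h6 : β ≤ 6) (h0' : 0 ≤ α') (h6' : β' ≤ 6)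
    (hd : β ≤ α' ∨ β' ≤ α)
    (hg : ∀ p q, Glue p q → p.1.im = 1 → q.1.im = 0 →
      ((α < p.1.re ∧ p.1.re < β) ∨ (α' < q.1.re ∧ q.1.re < β')) →
      q.1.re = l * (p.1.re - α) + α')
    (hg' : ∀ p q : polygon, p.1.im = 1 → q.1.im = 0 → α < p.1.re → p.1.re < β →
      q.1.re = l * (p.1.re - α) + α' → Glue p q) : Pieces Bool where
  W := fun
    | false => {z | (α < z.re ∧ z.re < β) ∧ 0 < z.im}
    | true => {z | (α' < z.re ∧ z.re < β') ∧ z.im < 1}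
  D := fun
    | false => fun z => z
    | true => fun z => r * z + ((α - r * α' : ℝ) + Complex.I)
  s := fun
    | false => fun z => z
    | true => fun z => l * (z - (α + Complex.I)) + α'
  C := fun
    | false => {z | z.im ≤ 1}
    | true => {z | 1 ≤ z.im}
  U := {z | (α < z.re ∧ z.re < β) ∧ 0 < z.im ∧ z.im < 1 + r}
  isOpen_W := by
    rintro (_ | _) <;> simp only [ofPred_and] <;>
    repeat' first | apply IsOpen.inter | (apply isOpen_lt <;> fun_prop)
  isOpen_U := by
    simp only [ofPred_and]
    repeat' first | apply IsOpen.inter | (apply isOpen_lt <;> fun_prop)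
  isClosed_C := by
    rintro (_ | _) <;> dsimp only <;> apply isClosed_le <;> fun_prop
  cover := by
    intro u _
    rcases le_total u.im 1 with h | h
    · exact ⟨false, h⟩
    · exact ⟨true, h⟩
  continuous_D := by rintro (_ | _) <;> dsimp only <;> fun_prop
  continuous_s := by rintro (_ | _) <;> dsimp only <;> fun_prop
  D_mem := by
    rintro (_ | _) z hz hW
    · simp [polygon] at *; grind
    · obtain ⟨⟨h1, h2⟩, h3⟩ := hW
      obtain ⟨_, h4, h5⟩ := hz
      have e : r * (β' - α') = β - α := by rw [hl]; linear_combination (β - α) * hlr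
      simp only [mem_ofPred_eq, Complex.add_re, Complex.add_im, Complex.mul_re, Complex.mul_im,
        Complex.ofReal_re, Complex.ofReal_im, Complex.I_re, Complex.I_im]
      refine ⟨⟨⟨?_, ?_⟩, ?_, ?_⟩, ?_⟩ <;> nlinarith
  s_mem := by
    have hl0 : 0 < l := by
      by_contra h
      nlinarith
    rintro (_ | _) u ⟨⟨h1, h2⟩, h3, h4⟩ hC
    · simp [polygon] at *; grind
    · have hC' : 1 ≤ u.im := hC
      have k1 : 0 < l * (u.re - α) := mul_pos hl0 (by linarith)
      have k2 : 0 < l * (β - u.re) := mul_pos hl0 (by linarith)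
      have k3 : 0 ≤ l * (u.im - 1) := mul_nonneg hl0.le (by linarith)
      have k4 : 0 < l * (1 + r - u.im) := mul_pos hl0 (by linarith)
      simp only [polygon, mem_ofPred_eq, Complex.add_re, Complex.add_im, Complex.mul_re,
        Complex.mul_im, Complex.sub_re, Complex.sub_im,
        Complex.ofReal_re, Complex.ofReal_im, Complex.I_re, Complex.I_im]
      refine ⟨⟨⟨?_, ?_⟩, ?_, ?_⟩, ⟨?_, ?_⟩, ?_⟩ <;> nlinarith
  D_s := by
    have : (l : ℂ) * r = 1 := by exact_mod_cast hlr
    rintro (_ | _) u _ _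
    · rfl
    · dsimp only; push_cast; linear_combination (u - α - Complex.I) * this
  s_D := by
    have : (l : ℂ) * r = 1 := by exact_mod_cast hlr
    rintro (_ | _) u _ _
    · rfl
    · dsimp only; push_cast; linear_combination (u - α') * this
  disj := by
    rintro (_ | _) (_ | _) <;> simp <;> grind
  glue := by
    have hl0 : 0 < l := by
      by_contra h
      nlinarith
    intro p q h i hi
    have hG := hg p q h
    have hrl : (r : ℂ) * l = 1 := by rw [mul_comm]; exact_mod_cast hlr
    rcases i with _ | _
    · obtain ⟨⟨h1, h2⟩, h3⟩ := hi
      rcases h with ⟨h, _⟩ | ⟨k1, k2, _⟩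
      · linarith
      · have e := hG k1 k2 (Or.inl ⟨h1, h2⟩)
        have k3 : 0 < l * (p.1.re - α) := mul_pos hl0 (by linarith)
        have k4 : 0 < l * (β - p.1.re) := mul_pos hl0 (by linarith)
        refine ⟨true, ⟨⟨?_, ?_⟩, ?_⟩, ?_⟩
        · linarith
        · nlinarith
        · linarith
        · have e1 : q.1 = ((l * (p.1.re - α) + α' : ℝ) : ℂ) := by
            apply Complex.ext <;> simp [e, k2]
          have e2 : p.1 = (p.1.re : ℂ) + Complex.I := by
            apply Complex.ext <;> simp [k1]
          dsimp only
          rw [e1, e2]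
          push_cast
          simp only [Complex.add_re, Complex.ofReal_re, Complex.I_re, add_zero]
          linear_combination ((p.1.re : ℂ) - α) * hrl
    · obtain ⟨⟨h1, h2⟩, h3⟩ := hi
      rcases h with ⟨h, _⟩ | ⟨k1, k2, _⟩ <;> linarith
  glue' := by
    have hl0 : 0 < l := by
      by_contra h
      nlinarith
    intro p q h i hi
    have hG := hg p q h
    have hrl : (r : ℂ) * l = 1 := by rw [mul_comm]; exact_mod_cast hlr
    rcases i with _ | _
    · obtain ⟨⟨h1, h2⟩, h3⟩ := hi
      rcases h with ⟨_, h, _⟩ | ⟨k1, k2, _⟩ <;> linarith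
    · obtain ⟨⟨h1, h2⟩, h3⟩ := hi
      rcases h with ⟨_, h, _⟩ | ⟨k1, k2, _⟩
      · linarith
      · have e := hG k1 k2 (Or.inr ⟨h1, h2⟩)
        have k3 : α < p.1.re := by nlinarith
        have k4 : p.1.re < β := by nlinarith
        refine ⟨false, ⟨⟨k3, k4⟩, ?_⟩, ?_⟩
        · linarith
        · have e1 : q.1 = ((l * (p.1.re - α) + α' : ℝ) : ℂ) := by
            apply Complex.ext <;> simp [e, k2]
          have e2 : p.1 = (p.1.re : ℂ) + Complex.I := by
            apply Complex.ext <;> simp [k1]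
          dsimp only
          rw [e1, e2]
          push_cast
          simp only [Complex.add_re, Complex.ofReal_re, Complex.I_re, add_zero]
          linear_combination -((p.1.re : ℂ) - α) * hrl
  same := by
    have hl0 : 0 < l := by
      by_contra h
      nlinarith
    have key : ∀ u : ℂ, α < u.re → u.re < β → u.im = 1 →
        Glue (clamp u) (clamp (l * (u - (α + Complex.I)) + α')) := by
      intro u h1 h2 h3
      have k1 : 0 < l * (u.re - α) := mul_pos hl0 (by linarith)
      have k2 : 0 < l * (β - u.re) := mul_pos hl0 (by linarith)
      have m1 : u ∈ polygon := ⟨⟨by linarith, by linarith⟩, by linarith, by linarith⟩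
      have m2 : l * (u - (α + Complex.I)) + α' ∈ polygon := by
        simp only [polygon, mem_ofPred_eq, Complex.add_re, Complex.add_im, Complex.mul_re,
          Complex.mul_im, Complex.sub_re, Complex.sub_im,
          Complex.ofReal_re, Complex.ofReal_im, Complex.I_re, Complex.I_im, h3]
        refine ⟨⟨?_, ?_⟩, ?_, ?_⟩ <;> nlinarith
      rw [clamp_of_mem m1, clamp_of_mem m2]
      exact hg' _ _ h3 (by simp [h3]) h1 h2 (by simp)
    rintro (_ | _) (_ | _) u hu hi hj
    · exact Or.inl rfl
    · exact Or.inr (Or.inr (Or.inr (Or.inl (key u hu.1.1 hu.1.2 (le_antisymm hi hj)))))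
    · exact Or.inr (Or.inr (Or.inr (Or.inr (key u hu.1.1 hu.1.2 (le_antisymm hj hi)))))
    · exact Or.inl rfl

/-- The gluing of `[0, 1]` to `[1, 3]`. -/
def edge₁ : Pieces Bool :=
  edgePieces 0 1 1 3 2 (1 / 2) (by norm_num) (by norm_num) (by norm_num) (by norm_num)
    (by norm_num) (by norm_num) (by norm_num) (by norm_num)
    (by intro p q h; simp only [Glue] at h; grind)
    (by intro p q h; simp only [Glue]; grind)

/-- The gluing of `[1, 3]` to `[0, 1]`. -/
def edge₂ : Pieces Bool :=
  edgePieces 1 3 0 1 (1 / 2) 2 (by norm_num) (by norm_num) (by norm_num) (by norm_num)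
    (by norm_num) (by norm_num) (by norm_num) (by norm_num)
    (by intro p q h; simp only [Glue] at h; grind)
    (by intro p q h; simp only [Glue]; grind)

/-- The gluing of `[3, 5]` to `[5, 6]`. -/
def edge₃ : Pieces Bool :=
  edgePieces 3 5 5 6 (1 / 2) 2 (by norm_num) (by norm_num) (by norm_num) (by norm_num)
    (by norm_num) (by norm_num) (by norm_num) (by norm_num)
    (by intro p q h; simp only [Glue] at h; grind)
    (by intro p q h; simp only [Glue]; grind)

/-- The gluing of `[5, 6]` to `[3, 5]`. -/
def edge₄ : Pieces Bool :=
  edgePieces 5 6 3 5 2 (1 / 2) (by norm_num) (by norm_num) (by norm_num) (by norm_num)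
    (by norm_num) (by norm_num) (by norm_num) (by norm_num)
    (by intro p q h; simp only [Glue] at h; grind)
    (by intro p q h; simp only [Glue]; grind)

/-- The atlas on the complement of the singular points. -/
def atlas : Set (OpenPartialHomeomorph Surface ℂ) :=
  {interiorPieces.chart, lateralPieces.chart, edge₁.chart, edge₂.chart, edge₃.chart, edge₄.chart}

theorem edgePieces_polyDil (α β α' β' l r : ℝ) (hr hlr hl h0 h6 h0' h6' hd hg hg') {p : polygon}
    (hp : proj p ∈ (edgePieces α β α' β' l r hr hlr hl h0 h6 h0' h6' hd hg hg').chart.source) :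
    PolyDil (edgePieces α β α' β' l r hr hlr hl h0 h6 h0' h6' hd hg hg').chart p := by
  refine Pieces.polyDil _ ?_ hp
  rintro (_ | _)
  · exact ⟨1, one_pos, 0, fun z _ => by simp [edgePieces]⟩
  · exact ⟨r, hr, _, fun z _ => rfl⟩

theorem atlas_polyDil {φ : OpenPartialHomeomorph Surface ℂ} (hφ : φ ∈ atlas) {p : polygon}
    (hp : proj p ∈ φ.source) : PolyDil φ p := by
  rcases hφ with rfl | rfl | rfl | rfl | rfl | rfl
  · refine Pieces.polyDil _ ?_ hp
    exact fun _ => ⟨1, one_pos, 0, fun z _ => by simp [interiorPieces]⟩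
  · refine Pieces.polyDil _ ?_ hp
    rintro (_ | _)
    · exact ⟨1, one_pos, 0, fun z _ => by simp [lateralPieces]⟩
    · exact ⟨1, one_pos, -6, fun z _ => by simp [lateralPieces, sub_eq_add_neg]⟩
  · exact edgePieces_polyDil _ _ _ _ _ _ _ _ _ _ _ _ _ _ _ _ hp
  · exact edgePieces_polyDil _ _ _ _ _ _ _ _ _ _ _ _ _ _ _ _ hp
  · exact edgePieces_polyDil _ _ _ _ _ _ _ _ _ _ _ _ _ _ _ _ hp
  · exact edgePieces_polyDil _ _ _ _ _ _ _ _ _ _ _ _ _ _ _ _ hp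

theorem mem_source_iff {ι : Type} [Finite ι] (P : Pieces ι) (p : polygon) :
    proj p ∈ P.chart.source ↔ ∃ i, p.1 ∈ P.W i := Iff.rfl

theorem atlas_cover : ⋃ φ ∈ atlas, φ.source = singᶜ := by
  ext x
  obtain ⟨p, rfl⟩ := surjective_proj x
  simp only [atlas, mem_iUnion, mem_insert_iff, mem_singleton_iff, exists_prop,
    exists_eq_or_imp, exists_eq_left, mem_source_iff, Bool.exists_bool, mem_compl_iff,
    proj_mem_sing, interiorPieces, lateralPieces, edge₁, edge₂, edge₃, edge₄, edgePieces,
    mem_ofPred_eq, exists_const, IsVertex]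
  obtain ⟨⟨x, y⟩, hp⟩ := p
  have hp' : (0 ≤ x ∧ x ≤ 6) ∧ 0 ≤ y ∧ y ≤ 1 := hp
  dsimp only
  have hy : y = 0 ∨ y = 1 ∨ (0 < y ∧ y < 1) := by grind
  have hx : x = 0 ∨ x = 1 ∨ x = 3 ∨ x = 5 ∨ x = 6 ∨ (0 < x ∧ x < 1) ∨ (1 < x ∧ x < 3) ∨
    (3 < x ∧ x < 5) ∨ (5 < x ∧ x < 6) := by grind
  rcases hx with rfl | rfl | rfl | rfl | rfl | hx | hx | hx | hx <;>
    rcases hy with rfl | rfl | hy <;> first | norm_num; done | grind (splits := 25)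

theorem isDilationAt_chart {F : Surface → ℂ} {φ : OpenPartialHomeomorph Surface ℂ}
    (hφ : φ ∈ atlas) {x : Surface} (hx : x ∈ φ.source)
    (hF : ∀ p, proj p = x → PolyDil F p) : IsDilationAt F φ x := by
  refine isDilationAt_of_polyDil ?_ hF fun p hp => atlas_polyDil hφ (hp ▸ hx)
  have : x ∈ ⋃ φ ∈ atlas, φ.source := mem_biUnion hφ hx
  rwa [atlas_cover] at this

/-- Real part of the square root of `z` with nonnegative real part. -/
def rootRe (z : ℂ) : ℝ := √((‖z‖ + z.re) / 2)

/-- Absolute value of the imaginary part of the square roots of `z`. -/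
def rootIm (z : ℂ) : ℝ := √((‖z‖ - z.re) / 2)

theorem rootRe_sq (z : ℂ) : rootRe z ^ 2 = (‖z‖ + z.re) / 2 :=
  Real.sq_sqrt (by linarith [neg_abs_le z.re, Complex.abs_re_le_norm z])

theorem rootIm_sq (z : ℂ) : rootIm z ^ 2 = (‖z‖ - z.re) / 2 :=
  Real.sq_sqrt (by linarith [le_abs_self z.re, Complex.abs_re_le_norm z])

theorem rootRe_nonneg (z : ℂ) : 0 ≤ rootRe z := Real.sqrt_nonneg _

theorem rootIm_nonneg (z : ℂ) : 0 ≤ rootIm z := Real.sqrt_nonneg _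

theorem rootRe_mul_rootIm (z : ℂ) : 2 * (rootRe z * rootIm z) = |z.im| := by
  have h : (2 * (rootRe z * rootIm z)) ^ 2 = |z.im| ^ 2 := by
    rw [sq_abs, mul_pow, mul_pow, rootRe_sq, rootIm_sq]
    have := Complex.sq_norm z
    rw [Complex.normSq_apply] at this
    linear_combination this
  exact (pow_left_inj₀ (mul_nonneg zero_le_two (mul_nonneg (rootRe_nonneg z) (rootIm_nonneg z)))
    (abs_nonneg _) two_ne_zero).1 h

theorem norm_sq' (w : ℂ) : ‖w ^ 2‖ = w.re ^ 2 + w.im ^ 2 := by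
  rw [norm_pow, Complex.sq_norm, Complex.normSq_apply]; ring

theorem sq_re (w : ℂ) : (w ^ 2).re = w.re ^ 2 - w.im ^ 2 := by
  rw [pow_two, Complex.mul_re]; ring

theorem sq_im (w : ℂ) : (w ^ 2).im = 2 * (w.re * w.im) := by
  rw [pow_two, Complex.mul_im]; ring

theorem rootRe_of_sq (w : ℂ) : rootRe (w ^ 2) = |w.re| := by
  rw [rootRe, norm_sq', sq_re, ← Real.sqrt_sq_eq_abs]; ring_nf

theorem rootIm_of_sq (w : ℂ) : rootIm (w ^ 2) = |w.im| := by
  rw [rootIm, norm_sq', sq_re, ← Real.sqrt_sq_eq_abs]; ring_nf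

/-- The corners of the rectangle that form a small disc around the first singular point. -/
inductive Corner
  | a | b | c | d | e

namespace Corner

instance : Finite Corner :=
  Finite.of_surjective (α := Fin 5) ![a, b, c, d, e] (by
    intro x
    cases x
    exacts [⟨0, rfl⟩, ⟨1, rfl⟩, ⟨2, rfl⟩, ⟨3, rfl⟩, ⟨4, rfl⟩])

/-- The vertex. -/
def v : Corner → ℂ
  | a => ⟨1, 0⟩ | b => ⟨0, 1⟩ | c => ⟨6, 1⟩ | d => ⟨5, 0⟩ | e => ⟨3, 1⟩

/-- The scale of the corner. -/
def l : Corner → ℝ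
  | a => 1 | b => 2 | c => 2 | d => 1 | e => 1 / 2

/-- The sign of the real part of the square root. -/
def sx : Corner → ℝ
  | a => 1 | b => 1 | c => 1 | d => -1 | e => -1

/-- The sign of the imaginary part of the square root. -/
def sy : Corner → ℝ
  | a => 1 | b => -1 | c => -1 | d => -1 | e => 1

/-- The sector of the disc. -/
def S : Corner → Set ℂ
  | a => {w | 0 ≤ w.re ∧ 0 ≤ w.im}
  | b => {w | 0 ≤ w.re ∧ w.im ≤ 0 ∧ 0 ≤ w.re + w.im}
  | c => {w | 0 ≤ w.re ∧ w.im ≤ 0 ∧ w.re + w.im ≤ 0}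
  | d => {w | w.re ≤ 0 ∧ w.im ≤ 0}
  | e => {w | w.re ≤ 0 ∧ 0 ≤ w.im}

/-- The coordinate at the corner. -/
def ζ (i : Corner) (z : ℂ) : ℂ := i.l * (z - i.v)

theorem ζ_re (i : Corner) (z : ℂ) : (i.ζ z).re = i.l * (z.re - i.v.re) := by simp [ζ]

theorem ζ_im (i : Corner) (z : ℂ) : (i.ζ z).im = i.l * (z.im - i.v.im) := by simp [ζ]

/-- The chart of the disc on the corner. -/
def D (i : Corner) (z : ℂ) : ℂ := ⟨i.sx * rootRe (i.ζ z), i.sy * rootIm (i.ζ z)⟩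

/-- The inverse of the chart. -/
def s (i : Corner) (w : ℂ) : ℂ := ⟨i.v.re + (w.re ^ 2 - w.im ^ 2) / i.l,
  i.v.im + 2 * (w.re * w.im) / i.l⟩

theorem l_pos (i : Corner) : 0 < i.l := by cases i <;> norm_num [l]

theorem sx_sq (i : Corner) : i.sx ^ 2 = 1 := by cases i <;> norm_num [sx]

theorem sy_sq (i : Corner) : i.sy ^ 2 = 1 := by cases i <;> norm_num [sy]

theorem ζ_s (i : Corner) (w : ℂ) : i.ζ (i.s w) = w ^ 2 := by
  have := i.l_pos.ne'
  apply Complex.ext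
  · rw [ζ_re, sq_re]; simp only [s]; field_simp; ring
  · rw [ζ_im, sq_im]; simp only [s]; field_simp; ring

theorem norm_D (i : Corner) (z : ℂ) : ‖i.D z‖ ^ 2 = ‖i.ζ z‖ := by
  rw [Complex.sq_norm, Complex.normSq_apply]
  simp only [D]
  have h1 := rootRe_sq (i.ζ z)
  have h2 := rootIm_sq (i.ζ z)
  linear_combination rootRe (i.ζ z) ^ 2 * i.sx_sq + rootIm (i.ζ z) ^ 2 * i.sy_sq + h1 + h2

theorem sign (i : Corner) {z : ℂ} (hz : z ∈ polygon) : i.sx * i.sy * |(i.ζ z).im| = (i.ζ z).im := by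
  obtain ⟨_, h0, h1⟩ := hz
  rw [ζ_im]
  cases i <;> simp only [sx, sy, l, v]
  · rw [abs_of_nonneg (by linarith)]; ring
  · rw [abs_of_nonpos (by linarith)]; ring
  · rw [abs_of_nonpos (by linarith)]; ring
  · rw [abs_of_nonneg (by linarith)]; ring
  · rw [abs_of_nonpos (by linarith)]; ring

theorem D_sq (i : Corner) {z : ℂ} (hz : z ∈ polygon) : i.D z ^ 2 = i.ζ z := by
  have h1 := rootRe_sq (i.ζ z)
  have h2 := rootIm_sq (i.ζ z)
  apply Complex.ext
  · rw [sq_re]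
    simp only [D]
    linear_combination rootRe (i.ζ z) ^ 2 * i.sx_sq - rootIm (i.ζ z) ^ 2 * i.sy_sq + h1 - h2
  · rw [sq_im, ← i.sign hz, ← rootRe_mul_rootIm]
    simp only [D]
    ring

theorem s_D (i : Corner) {z : ℂ} (hz : z ∈ polygon) : i.s (i.D z) = z := by
  have h := i.ζ_s (i.D z)
  rw [i.D_sq hz, ζ, ζ] at h
  have : (i.l : ℂ) ≠ 0 := by exact_mod_cast i.l_pos.ne'
  exact sub_left_injective (mul_left_cancel₀ this h)

theorem D_s (i : Corner) {w : ℂ} (hw : w ∈ i.S) : i.D (i.s w) = w := by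
  rw [D, ζ_s, rootRe_of_sq, rootIm_of_sq]
  apply Complex.ext <;> cases i <;> simp only [S, mem_ofPred_eq] at hw <;> simp only [sx, sy] <;>
    grind

theorem D_congr {i j : Corner} {z z' : ℂ} (h : i.ζ z = j.ζ z')
    (h1 : i.sx = j.sx ∨ (i.ζ z).im = 0 ∧ (i.ζ z).re ≤ 0)
    (h2 : i.sy = j.sy ∨ (i.ζ z).im = 0 ∧ 0 ≤ (i.ζ z).re) : i.D z = j.D z' := by
  rw [D, D, ← h]
  have hn : (i.ζ z).im = 0 → ‖i.ζ z‖ = |(i.ζ z).re| := by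
    intro h
    rw [Complex.norm_eq_sqrt_sq_add_sq, h, zero_pow two_ne_zero, add_zero, Real.sqrt_sq_eq_abs]
  apply Complex.ext <;> dsimp only
  · rcases h1 with h1 | ⟨h1, h1'⟩
    · rw [h1]
    · have : rootRe (i.ζ z) = 0 := by
        rw [rootRe, hn h1, abs_of_nonpos h1']; simp
      rw [this]; simp
  · rcases h2 with h2 | ⟨h2, h2'⟩
    · rw [h2]
    · have : rootIm (i.ζ z) = 0 := by
        rw [rootIm, hn h2, abs_of_nonneg h2']; simp
      rw [this]; simp

/-- The small discs around the vertices. -/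
def W (i : Corner) : Set ℂ := {z | ‖i.ζ z‖ < 1 / 4}

theorem W_bounds {i : Corner} {z : ℂ} (h : z ∈ i.W) :
    (-(1 / 4) < i.l * (z.re - i.v.re) ∧ i.l * (z.re - i.v.re) < 1 / 4) ∧
    (-(1 / 4) < i.l * (z.im - i.v.im) ∧ i.l * (z.im - i.v.im) < 1 / 4) := by
  have h' : ‖i.ζ z‖ < 1 / 4 := h
  have h1 := abs_lt.1 ((Complex.abs_re_le_norm _).trans_lt h')
  have h2 := abs_lt.1 ((Complex.abs_im_le_norm _).trans_lt h')
  rw [ζ_re] at h1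
  rw [ζ_im] at h2
  exact ⟨h1, h2⟩

theorem glue_aux {p q : polygon} {i : Corner} (j : Corner) (hi : p.1 ∈ i.W)
    (h : i.ζ p.1 = j.ζ q.1)
    (h1 : i.sx = j.sx ∨ (i.ζ p.1).im = 0 ∧ (i.ζ p.1).re ≤ 0)
    (h2 : i.sy = j.sy ∨ (i.ζ p.1).im = 0 ∧ 0 ≤ (i.ζ p.1).re) :
    ∃ j : Corner, q.1 ∈ j.W ∧ j.D q.1 = i.D p.1 := by
  refine ⟨j, ?_, (D_congr h h1 h2).symm⟩
  rw [W, mem_ofPred_eq, ← h]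
  exact hi

theorem glue {p q : polygon} (h : Glue p q) {i : Corner} (hi : p.1 ∈ i.W) :
    ∃ j : Corner, q.1 ∈ j.W ∧ j.D q.1 = i.D p.1 := by
  have hb := W_bounds hi
  have hp := p.2
  have hq := q.2
  have h' := h
  simp only [Glue] at h'
  simp only [polygon, mem_ofPred_eq] at hp hq
  cases i
  · simp only [l, v] at hb; exfalso; grind
  · simp only [l, v] at hb
    rcases h' with ⟨k1, k2, k3⟩ | ⟨k1, k2, k3⟩
    · refine glue_aux c hi ?_ (Or.inl rfl) (Or.inl rfl)
      apply Complex.ext <;> simp only [ζ_re, ζ_im, l, v] <;> grind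
    · have k4 : q.1.re = 2 * p.1.re + 1 := by grind
      refine glue_aux a hi ?_ (Or.inl rfl) (Or.inr ?_)
      · apply Complex.ext <;> simp only [ζ_re, ζ_im, l, v] <;> grind
      · simp only [ζ_re, ζ_im, l, v]; grind
  · simp only [l, v] at hb
    have k1 : p.1.im = 1 := by grind
    have k2 : q.1.im = 0 := by grind
    have k4 : q.1.re = 2 * (p.1.re - 5) + 3 := by grind
    refine glue_aux d hi ?_ (Or.inr ?_) (Or.inl rfl)
    · apply Complex.ext <;> simp only [ζ_re, ζ_im, l, v] <;> grind
    · simp only [ζ_re, ζ_im, l, v]; grind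
  · simp only [l, v] at hb; exfalso; grind
  · simp only [l, v] at hb
    have k1 : p.1.im = 1 := by grind
    have k2 : q.1.im = 0 := by grind
    have k5 : (p.1.re ≤ 3 ∧ q.1.re = (p.1.re - 1) / 2) ∨
        (3 ≤ p.1.re ∧ q.1.re = (p.1.re - 3) / 2 + 5) := by grind
    clear h'
    rcases k5 with ⟨k3, k4⟩ | ⟨k3, k4⟩
    · refine glue_aux a hi ?_ (Or.inr ?_) (Or.inl rfl)
      · apply Complex.ext <;> simp only [ζ_re, ζ_im, l, v] <;> grind
      · simp only [ζ_re, ζ_im, l, v]; grind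
    · refine glue_aux d hi ?_ (Or.inl rfl) (Or.inr ?_)
      · apply Complex.ext <;> simp only [ζ_re, ζ_im, l, v] <;> grind
      · simp only [ζ_re, ζ_im, l, v]; grind

theorem glue' {p q : polygon} (h : Glue p q) {i : Corner} (hi : q.1 ∈ i.W) :
    ∃ j : Corner, p.1 ∈ j.W ∧ j.D p.1 = i.D q.1 := by
  have hb := W_bounds hi
  have hp := p.2
  have hq := q.2
  have h' := h
  have aux : ∀ j : Corner, i.ζ q.1 = j.ζ p.1 →
      (i.sx = j.sx ∨ (i.ζ q.1).im = 0 ∧ (i.ζ q.1).re ≤ 0) →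
      (i.sy = j.sy ∨ (i.ζ q.1).im = 0 ∧ 0 ≤ (i.ζ q.1).re) →
      ∃ j : Corner, p.1 ∈ j.W ∧ j.D p.1 = i.D q.1 := by
    intro j h h1 h2
    refine ⟨j, ?_, (D_congr h h1 h2).symm⟩
    rw [W, mem_ofPred_eq, ← h]
    exact hi
  simp only [Glue] at h'
  simp only [polygon, mem_ofPred_eq] at hp hq
  cases i
  · simp only [l, v] at hb
    have k1 : p.1.im = 1 := by grind
    have k2 : q.1.im = 0 := by grind
    have k5 : (q.1.re ≤ 1 ∧ q.1.re = (p.1.re - 1) / 2) ∨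
        (1 ≤ q.1.re ∧ q.1.re = 2 * p.1.re + 1) := by grind
    clear h'
    rcases k5 with ⟨k3, k4⟩ | ⟨k3, k4⟩
    · refine aux e ?_ (Or.inr ?_) (Or.inl rfl)
      · apply Complex.ext <;> simp only [ζ_re, ζ_im, l, v] <;> grind
      · simp only [ζ_re, ζ_im, l, v]; grind
    · refine aux b ?_ (Or.inl rfl) (Or.inr ?_)
      · apply Complex.ext <;> simp only [ζ_re, ζ_im, l, v] <;> grind
      · simp only [ζ_re, ζ_im, l, v]; grind
  · simp only [l, v] at hb; exfalso; grind
  · simp only [l, v] at hb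
    have k1 : p.1.re = 0 := by grind
    have k2 : q.1.re = 6 := by grind
    have k3 : q.1.im = p.1.im := by grind
    refine aux b ?_ (Or.inl rfl) (Or.inl rfl)
    apply Complex.ext <;> simp only [ζ_re, ζ_im, l, v] <;> grind
  · simp only [l, v] at hb
    have k1 : p.1.im = 1 := by grind
    have k2 : q.1.im = 0 := by grind
    have k5 : (q.1.re ≤ 5 ∧ q.1.re = 2 * (p.1.re - 5) + 3) ∨
        (5 ≤ q.1.re ∧ q.1.re = (p.1.re - 3) / 2 + 5) := by grind
    clear h'
    rcases k5 with ⟨k3, k4⟩ | ⟨k3, k4⟩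
    · refine aux c ?_ (Or.inr ?_) (Or.inl rfl)
      · apply Complex.ext <;> simp only [ζ_re, ζ_im, l, v] <;> grind
      · simp only [ζ_re, ζ_im, l, v]; grind
    · refine aux e ?_ (Or.inl rfl) (Or.inr ?_)
      · apply Complex.ext <;> simp only [ζ_re, ζ_im, l, v] <;> grind
      · simp only [ζ_re, ζ_im, l, v]; grind
  · simp only [l, v] at hb; exfalso; grind

theorem s_mem (i : Corner) {w : ℂ} (hw : ‖w‖ < 1 / 2) (hS : w ∈ i.S) :
    i.s w ∈ polygon ∧ i.s w ∈ i.W := by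
  have h1 : w.re ^ 2 + w.im ^ 2 < 1 / 4 := by
    rw [← norm_sq', norm_pow]; nlinarith [norm_nonneg w]
  refine ⟨?_, ?_⟩
  · have a1 := sq_nonneg w.re
    have a2 := sq_nonneg w.im
    have a3 := sq_nonneg (w.re - w.im)
    have a4 := sq_nonneg (w.re + w.im)
    cases i <;> simp only [S, mem_ofPred_eq] at hS <;>
      simp only [s, polygon, mem_ofPred_eq, l, v] <;>
      refine ⟨⟨?_, ?_⟩, ?_, ?_⟩ <;> nlinarith
  · rw [W, mem_ofPred_eq, ζ_s, norm_sq']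
    exact h1

theorem same_aux {i j : Corner} {w : ℂ} (hw : ‖w‖ < 1 / 2) (hi : w ∈ i.S) (hj : w ∈ j.S)
    (h : ∀ h1 h2, Rel ⟨i.s w, h1⟩ ⟨j.s w, h2⟩) : Rel (clamp (i.s w)) (clamp (j.s w)) := by
  rw [clamp_of_mem (s_mem i hw hi).1, clamp_of_mem (s_mem j hw hj).1]
  exact h _ _

theorem same {i j : Corner} {w : ℂ} (hw : ‖w‖ < 1 / 2) (hi : w ∈ i.S) (hj : w ∈ j.S) :
    Rel (clamp (i.s w)) (clamp (j.s w)) := by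
  refine same_aux hw hi hj fun m1 m2 => ?_
  by_cases h0 : w = 0
  · subst h0
    right; left
    constructor <;> [cases i; cases j] <;> simp [V1, s, v]
  have h0' : w.re = 0 → w.im = 0 → False := fun h h' => h0 (Complex.ext h h')
  have h1 : w.re ^ 2 + w.im ^ 2 < 1 / 4 := by
    rw [← norm_sq', norm_pow]; nlinarith [norm_nonneg w]
  have a1 := sq_nonneg w.re
  have a2 := sq_nonneg w.im
  clear hw h0
  obtain ⟨x, y⟩ := w
  dsimp only at h0' h1 a1 a2
  have gl : ∀ {p q : polygon}, Glue p q → Rel p q :=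
    fun h => Or.inr (Or.inr (Or.inr (Or.inl h)))
  have Rba : ∀ m1 m2, y = 0 → 0 ≤ x → Rel ⟨b.s ⟨x, y⟩, m1⟩ ⟨a.s ⟨x, y⟩, m2⟩ := by
    rintro m1 m2 rfl hx
    apply gl
    simp only [Glue, s, l, v]
    refine Or.inr ⟨by norm_num, by norm_num, Or.inl ⟨?_, ?_, ?_⟩⟩ <;> nlinarith
  have Rea : ∀ m1 m2, x = 0 → 0 ≤ y → Rel ⟨e.s ⟨x, y⟩, m1⟩ ⟨a.s ⟨x, y⟩, m2⟩ := by
    rintro m1 m2 rfl hx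
    apply gl
    simp only [Glue, s, l, v]
    refine Or.inr ⟨by norm_num, by norm_num, Or.inr (Or.inl ⟨?_, ?_, ?_⟩)⟩ <;> nlinarith
  have Red : ∀ m1 m2, y = 0 → x ≤ 0 → Rel ⟨e.s ⟨x, y⟩, m1⟩ ⟨d.s ⟨x, y⟩, m2⟩ := by
    rintro m1 m2 rfl hx
    apply gl
    simp only [Glue, s, l, v]
    refine Or.inr ⟨by norm_num, by norm_num, Or.inr (Or.inr (Or.inl ⟨?_, ?_, ?_⟩))⟩ <;> nlinarith
  have Rcd : ∀ m1 m2, x = 0 → y ≤ 0 → Rel ⟨c.s ⟨x, y⟩, m1⟩ ⟨d.s ⟨x, y⟩, m2⟩ := by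
    rintro m1 m2 rfl hx
    apply gl
    simp only [Glue, s, l, v]
    refine Or.inr ⟨by norm_num, by norm_num, Or.inr (Or.inr (Or.inr ⟨?_, ?_, ?_⟩))⟩ <;> nlinarith
  have Rbc : ∀ m1 m2, x + y = 0 → Rel ⟨b.s ⟨x, y⟩, m1⟩ ⟨c.s ⟨x, y⟩, m2⟩ := by
    intro m1 m2 h
    obtain rfl : y = -x := by linarith
    apply gl
    simp only [Glue, s, l, v]
    exact Or.inl ⟨by ring, by ring, trivial⟩
  cases i <;> cases j <;> simp only [S, mem_ofPred_eq] at hi hj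
  · exact Or.inl rfl
  · exact (Rba _ _ (by linarith) (by linarith)).symm
  · exact (h0' (by linarith) (by linarith)).elim
  · exact (h0' (by linarith) (by linarith)).elim
  · exact (Rea _ _ (by linarith) (by linarith)).symm
  · exact Rba _ _ (by linarith) (by linarith)
  · exact Or.inl rfl
  · exact Rbc _ _ (by linarith)
  · exact (h0' (by linarith) (by linarith)).elim
  · exact (h0' (by linarith) (by linarith)).elim
  · exact (h0' (by linarith) (by linarith)).elim
  · exact (Rbc _ _ (by linarith)).symm
  · exact Or.inl rfl
  · exact Rcd _ _ (by linarith) (by linarith)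
  · exact (h0' (by linarith) (by linarith)).elim
  · exact (h0' (by linarith) (by linarith)).elim
  · exact (h0' (by linarith) (by linarith)).elim
  · exact (Rcd _ _ (by linarith) (by linarith)).symm
  · exact Or.inl rfl
  · exact (Red _ _ (by linarith) (by linarith)).symm
  · exact Rea _ _ (by linarith) (by linarith)
  · exact (h0' (by linarith) (by linarith)).elim
  · exact (h0' (by linarith) (by linarith)).elim
  · exact Red _ _ (by linarith) (by linarith)
  · exact Or.inl rfl

/-- The disc of angle `4π` around the first singular point. -/
def pieces : Pieces Corner where
  W := W
  D := D
  s := s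
  C := S
  U := Metric.ball 0 (1 / 2)
  isOpen_W i := isOpen_lt (by unfold ζ; fun_prop) continuous_const
  isOpen_U := Metric.isOpen_ball
  isClosed_C i := by
    cases i <;> simp only [S, ofPred_and] <;>
    repeat' first | apply IsClosed.inter | (apply isClosed_le <;> fun_prop)
  cover := by
    intro u _
    rcases le_total 0 u.re with h | h <;> rcases le_total 0 u.im with h' | h'
    · exact ⟨a, h, h'⟩
    · rcases le_total 0 (u.re + u.im) with h'' | h''
      · exact ⟨b, h, h', h''⟩
      · exact ⟨c, h, h', h''⟩
    · exact ⟨e, h, h'⟩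
    · exact ⟨d, h, h'⟩
  continuous_D i := by
    have : i.D = fun z => ((i.sx * rootRe (i.ζ z) : ℝ) : ℂ) +
        ((i.sy * rootIm (i.ζ z) : ℝ) : ℂ) * Complex.I := by
      ext z; rw [D, Complex.mk_eq_add_mul_I]
    rw [this]
    unfold rootRe rootIm ζ
    fun_prop
  continuous_s i := by
    have : i.s = fun w => i.v + w ^ 2 / i.l := by
      ext w
      have h := i.ζ_s w
      have : (i.l : ℂ) ≠ 0 := by exact_mod_cast i.l_pos.ne'
      rw [← h, ζ]
      field_simp
      ring
    rw [this]
    have : (i.l : ℂ) ≠ 0 := by exact_mod_cast i.l_pos.ne'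
    fun_prop
  D_mem i z hz hW := by
    have h : ‖i.ζ z‖ < 1 / 4 := hW
    constructor
    · rw [mem_ball_zero_iff]
      rw [← norm_D] at h
      nlinarith [norm_nonneg (i.D z)]
    · have hb := W_bounds hW
      have r1 := rootRe_nonneg (i.ζ z)
      have r2 := rootIm_nonneg (i.ζ z)
      have r3 := rootRe_sq (i.ζ z)
      have r4 := rootIm_sq (i.ζ z)
      obtain ⟨⟨h1, h2⟩, h3, h4⟩ := hz
      cases i
      · simp only [S, D, sx, sy, mem_ofPred_eq]; grind
      · simp only [S, D, sx, sy, mem_ofPred_eq]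
        have : 0 ≤ (ζ b z).re := by rw [ζ_re]; simp only [l, v]; linarith
        refine ⟨by linarith, by linarith, ?_⟩
        nlinarith
      · simp only [S, D, sx, sy, mem_ofPred_eq]
        have : (ζ c z).re ≤ 0 := by rw [ζ_re]; simp only [l, v]; linarith
        refine ⟨by linarith, by linarith, ?_⟩
        nlinarith
      · simp only [S, D, sx, sy, mem_ofPred_eq]; grind
      · simp only [S, D, sx, sy, mem_ofPred_eq]; grind
  s_mem i u hu hC := i.s_mem (mem_ball_zero_iff.1 hu) hC
  D_s i u _ hC := i.D_s hC
  s_D i z hz _ := i.s_D hz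
  disj i j z hz hi hj := by
    have h1 := W_bounds hi
    have h2 := W_bounds hj
    cases i <;> cases j <;> first | rfl | (exfalso; simp only [l, v] at h1 h2; linarith)
  glue p q h i hi := glue h hi
  glue' p q h i hi := glue' h hi
  same i j u hu hi hj := same (mem_ball_zero_iff.1 hu) hi hj

end Corner

/-- The rotation of the rectangle by the angle `π`. -/
def rotPolygon (p : polygon) : polygon :=
  ⟨6 + Complex.I - p.1, by
    obtain ⟨⟨h1, h2⟩, h3, h4⟩ := p.2
    refine ⟨⟨?_, ?_⟩, ?_, ?_⟩ <;> simp <;> linarith⟩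

theorem rotPolygon_re (p : polygon) : (rotPolygon p).1.re = 6 - p.1.re := by simp [rotPolygon]

theorem rotPolygon_im (p : polygon) : (rotPolygon p).1.im = 1 - p.1.im := by simp [rotPolygon]

theorem rotPolygon_rotPolygon (p : polygon) : rotPolygon (rotPolygon p) = p :=
  ext' (by simp [rotPolygon_re]) (by simp [rotPolygon_im])

theorem continuous_rotPolygon : Continuous rotPolygon :=
  Continuous.subtype_mk (by fun_prop) _

theorem glue_rot {p q : polygon} (h : Glue p q) : Glue (rotPolygon q) (rotPolygon p) := by
  simp only [Glue, rotPolygon_re, rotPolygon_im] at *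
  rcases h with ⟨h1, h2, h3⟩ | ⟨h1, h2, h | h | h | h⟩
  · exact Or.inl ⟨by linarith, by linarith, by linarith⟩
  · exact Or.inr ⟨by linarith, by linarith,
      Or.inr (Or.inr (Or.inl ⟨by linarith, by linarith, by linarith⟩))⟩
  · exact Or.inr ⟨by linarith, by linarith,
      Or.inr (Or.inr (Or.inr ⟨by linarith, by linarith, by linarith⟩))⟩
  · exact Or.inr ⟨by linarith, by linarith, Or.inl ⟨by linarith, by linarith, by linarith⟩⟩
  · exact Or.inr ⟨by linarith, by linarith,
      Or.inr (Or.inl ⟨by linarith, by linarith, by linarith⟩)⟩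

/-- The rotation of the surface by the angle `π`. -/
def rotFun : Surface → Surface :=
  Quot.lift (fun p => proj (rotPolygon p)) fun _ _ h => (Quot.sound (glue_rot h)).symm

theorem rotFun_proj (p : polygon) : rotFun (proj p) = proj (rotPolygon p) := rfl

theorem rotFun_rotFun (x : Surface) : rotFun (rotFun x) = x := by
  obtain ⟨p, rfl⟩ := surjective_proj x
  rw [rotFun_proj, rotFun_proj, rotPolygon_rotPolygon]

theorem continuous_rotFun : Continuous rotFun :=
  continuous_quot_lift _ (continuous_proj.comp continuous_rotPolygon)

/-- The rotation of the surface by the angle `π`, as a homeomorphism. -/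
def rot : Surface ≃ₜ Surface where
  toFun := rotFun
  invFun := rotFun
  left_inv := rotFun_rotFun
  right_inv := rotFun_rotFun
  continuous_toFun := continuous_rotFun
  continuous_invFun := continuous_rotFun

/-- The chart, with values in the cone of angle `4π`, around the first singular point. -/
def cone₁ : OpenPartialHomeomorph Surface ℂ := Corner.pieces.chart

/-- The chart, with values in the cone of angle `4π`, around the second singular point. -/
def cone₂ : OpenPartialHomeomorph Surface ℂ :=
  (rot.transOpenPartialHomeomorph cone₁).transHomeomorph
    (Homeomorph.mulLeft₀ Complex.I Complex.I_ne_zero)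

theorem cone₂_apply (x : Surface) : cone₂ x = Complex.I * cone₁ (rotFun x) := rfl

theorem mem_cone₂_source (x : Surface) : x ∈ cone₂.source ↔ rotFun x ∈ cone₁.source := Iff.rfl

theorem cone₁_polyDil {p : polygon} (hp : proj p ∈ cone₁.source) :
    PolyDil (fun y => cone₁ y ^ 2) p := by
  obtain ⟨i, hi⟩ := hp
  refine ⟨i.l, i.l_pos, -(i.l * i.v), ?_⟩
  filter_upwards [continuous_subtype_val.continuousAt.eventually
    ((Corner.pieces.isOpen_W i).mem_nhds hi)] with p' hp'
  have : cone₁ (proj p') = i.D p'.1 := Corner.pieces.toFun_proj hp'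
  rw [this, i.D_sq p'.2, Corner.ζ]
  ring

theorem cone₂_polyDil {p : polygon} (hp : proj p ∈ cone₂.source) :
    PolyDil (fun y => cone₂ y ^ 2) p := by
  rw [mem_cone₂_source, rotFun_proj] at hp
  obtain ⟨a, ha, b, h⟩ := cone₁_polyDil hp
  refine ⟨a, ha, -(a * (6 + Complex.I) + b), ?_⟩
  filter_upwards [continuous_rotPolygon.continuousAt.eventually h] with p' h
  rw [cone₂_apply, rotFun_proj, mul_pow, h, Complex.I_sq, rotPolygon]
  ring

theorem corner_vertex {p : polygon} (h : proj p ∈ cone₁.source) (hp : IsVertex p) : V1 p := by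
  obtain ⟨i, hi⟩ := h
  have hb := Corner.W_bounds hi
  unfold IsVertex at hp
  unfold V1
  cases i <;> simp only [Corner.l, Corner.v] at hb <;> grind

theorem cone₁_V1 {p : polygon} (hp : V1 p) : proj p ∈ cone₁.source ∧ cone₁ (proj p) = 0 := by
  rw [proj_V1 hp]
  have h0 : Corner.a.ζ ⟨1, 0⟩ = 0 := by
    apply Complex.ext <;> simp [Corner.ζ_re, Corner.ζ_im, Corner.v]
  have h : (⟨1, 0⟩ : ℂ) ∈ Corner.a.W := by
    rw [Corner.W, mem_ofPred_eq, h0]; norm_num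
  refine ⟨⟨Corner.a, h⟩, ?_⟩
  have : cone₁ (proj ⟨⟨1, 0⟩, mem_mk (by norm_num)⟩) = Corner.a.D ⟨1, 0⟩ :=
    Corner.pieces.toFun_proj (p := ⟨⟨1, 0⟩, mem_mk (by norm_num)⟩) h
  rw [this, Corner.D, h0]
  apply Complex.ext <;> simp [rootRe, rootIm]

theorem V1_rot {p : polygon} : V1 (rotPolygon p) ↔ V2 p := by
  simp only [V1, V2, rotPolygon_re, rotPolygon_im]
  grind

theorem isVertex_rot {p : polygon} : IsVertex (rotPolygon p) ↔ IsVertex p := by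
  simp only [IsVertex, rotPolygon_re, rotPolygon_im]
  grind

theorem cone_aux (s : Surface) (hs : s ∈ sing) : ∃ k : ℕ, 1 ≤ k ∧
    ∃ h : OpenPartialHomeomorph Surface ℂ,
      s ∈ h.source ∧ h s = 0 ∧ h.source ∩ sing = {s} ∧
      ∀ φ ∈ atlas, ∀ x ∈ h.source ∩ φ.source, IsDilationAt (fun y => h y ^ k) φ x := by
  obtain ⟨p, hp, rfl⟩ := hs
  refine ⟨2, one_le_two, ?_⟩
  rcases (isVertex_iff p).1 hp with hv | hv
  · obtain ⟨h1, h2⟩ := cone₁_V1 hv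
    refine ⟨cone₁, h1, h2, ?_, ?_⟩
    · ext x
      obtain ⟨q, rfl⟩ := surjective_proj x
      constructor
      · rintro ⟨h3, h4⟩
        have hq := corner_vertex h3 (proj_mem_sing.1 h4)
        rw [mem_singleton_iff, proj_V1 hv, proj_V1 hq]
      · intro h
        rw [mem_singleton_iff.1 h]
        exact ⟨h1, proj_mem_sing.2 hp⟩
    · rintro φ hφ x ⟨hx, hx'⟩
      exact isDilationAt_chart hφ hx' fun q hq => cone₁_polyDil (hq ▸ hx)
  · obtain ⟨h1, h2⟩ := cone₁_V1 (V1_rot.2 hv)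
    have h1' : proj p ∈ cone₂.source := h1
    refine ⟨cone₂, h1', ?_, ?_, ?_⟩
    · rw [cone₂_apply, rotFun_proj, h2, mul_zero]
    · ext x
      obtain ⟨q, rfl⟩ := surjective_proj x
      constructor
      · rintro ⟨h3, h4⟩
        have h3' : proj (rotPolygon q) ∈ cone₁.source := h3
        have hq := V1_rot.1 (corner_vertex h3' (isVertex_rot.2 (proj_mem_sing.1 h4)))
        rw [mem_singleton_iff, proj_V2 hv, proj_V2 hq]
      · intro h
        rw [mem_singleton_iff.1 h]
        exact ⟨h1', proj_mem_sing.2 hp⟩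
    · rintro φ hφ x ⟨hx, hx'⟩
      exact isDilationAt_chart hφ hx' fun q hq => cone₂_polyDil (hq ▸ hx)

end Disco

/-- The Disco surface. -/
def discoSurface : AffineSurface Disco.Surface where
  t2 := inferInstance
  connected := inferInstance
  sing := Disco.sing
  sing_finite := Disco.sing_finite
  atlas := Disco.atlas
  cover := Disco.atlas_cover
  transition _ hφ _ hψ _ hx :=
    Disco.isDilationAt_chart hφ hx.1 fun _ hp => Disco.atlas_polyDil hψ (hp ▸ hx.2)
  cone := Disco.cone_aux

/-- The group `Γ`. -/
def discoGamma : Subgroup (Matrix.SpecialLinearGroup (Fin 2) ℝ) :=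
  Subgroup.closure {⟨!![1, 6; 0, 1], by simp⟩, ⟨!![1, 0; 3 / 2, 1], by simp⟩,
    ⟨!![-1, 0; 0, -1], by simp⟩}

end

/-! The Veech group is a group, so it suffices to realise each of the three generators of Γ by an
affine automorphism.

For `-1`: the half-turn `z ↦ 6 + i - z` of the rectangle exchanges the two sides of every gluing, so
it descends to the involution `rot`.

For the horizontal generator: the rectangle closes up to one horizontal cylinder of circumference 6
and height 1. The shear `(x, y) ↦ (x + 6y, y)` moves the bottom by nothing and the top by one full
turn. It is therefore the identity on the boundary of the cylinder and respects any gluing of top to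
bottom, dilations included.

For the vertical generator: in the left half `[0, 3] × [0, 1]`, the top of the unit square `[0, 1] ×
[0, 1]` is glued to the bottom of `[1, 3] × [0, 1]`, and the top of the latter to the bottom of the
square. In the affine coordinate of the square the second rectangle has half its size, that is,
width 1 and height 1/2. The left half is thus the image of a vertical cylinder of width 1 and
circumference 1 + 1/2 = 3/2, and the twist `(x, t) ↦ (x, t + 3x/2)` fixes both boundary curves
pointwise. The rotation exchanges the two halves, and conjugation by `-1` does not change a linear
part, so the conjugate twist on the right half completes the automorphism.

It remains to compute linear parts away from the singular points. Coordinates on the universal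
covers of the cylinders are affine (`locAff_hline`, `locAff_vline`), and along the vertical edges
the twist is the shear that fixes the edge (`verPolygon_near_edge`). `mem_veechGroup` turns such
computations on the rectangle into membership in the Veech group. -/

noncomputable section

/-! ### Periodic extension of families of closed curves -/

section Periodize

variable {α Y : Type*} {T : ℝ} (hT : 0 < T) (K : α → ℝ → Y)

/-- The extension of `K`, given on `[0, T)`, to a function of period `T`. -/
def periodize (a : α) (t : ℝ) : Y := K a (toIcoMod hT 0 t)

variable {K}

theorem periodize_add_zsmul (a : α) (t : ℝ) (n : ℤ) :
    periodize hT K a (t + n * T) = periodize hT K a t := by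
  rw [periodize, periodize, ← zsmul_eq_mul, toIcoMod_add_zsmul]

theorem periodize_add (a : α) (t : ℝ) : periodize hT K a (t + T) = periodize hT K a t := by
  simpa using periodize_add_zsmul hT (K := K) a t 1

include hT in
theorem exists_eq_add_period (t : ℝ) : ∃ n : ℤ, ∃ r : ℝ, 0 ≤ r ∧ r < T ∧ t = r + n * T := by
  have h := toIcoMod_mem_Ico' hT t
  exact ⟨_, _, h.1, h.2, by rw [← zsmul_eq_mul, toIcoMod_add_toIcoDiv_zsmul]⟩

variable (h0 : ∀ a, K a T = K a 0)

include h0 in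
-- The right endpoint is included because each curve closes up; both formulas are then available at
-- the seam.
theorem periodize_eq {a : α} {t : ℝ} (h : 0 ≤ t) (h' : t ≤ T) : periodize hT K a t = K a t := by
  rcases h'.eq_or_lt with rfl | h'
  · have := periodize_add hT (K := K) a 0
    rw [zero_add] at this
    rw [this, periodize, toIcoMod_apply_left, h0]
  · rw [periodize, (toIcoMod_eq_self hT).2 ⟨h, by simpa using h'⟩]

include h0 in
-- Only the multiples of `T` could cause trouble. Around `n * T` the extension is pasted from the
-- end of one copy of `K` and the beginning of the next, which agree there since the curves are
-- closed.
theorem continuous_periodize [TopologicalSpace α] [TopologicalSpace Y]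
    (hK : Continuous fun x : α × ℝ => K x.1 x.2) :
    Continuous fun x : α × ℝ => periodize hT K x.1 x.2 := by
  rw [continuous_iff_continuousAt]
  rintro ⟨a, t⟩
  obtain ⟨n, r, hr, hr', rfl⟩ := exists_eq_add_period hT t
  have hc : Continuous fun x : α × ℝ =>
      if x.2 ≤ n * T then K x.1 (x.2 - n * T + T) else K x.1 (x.2 - n * T) := by
    refine Continuous.if_le ?_ ?_ continuous_snd continuous_const ?_
    · exact hK.comp (f := fun x : α × ℝ => (x.1, x.2 - n * T + T)) (by fun_prop)
    · exact hK.comp (f := fun x : α × ℝ => (x.1, x.2 - n * T)) (by fun_prop)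
    · intro x hx
      rw [hx, sub_self, zero_add, h0]
  refine hc.continuousAt.congr ?_
  -- On this window of two periods the pasted function is the periodic extension; it contains `r + n
  -- * T` because `0 ≤ r < T`.
  have h1 : ∀ᶠ x : α × ℝ in 𝓝 (a, r + n * T), n * T - T < x.2 ∧ x.2 < n * T + T :=
    continuous_snd.continuousAt.eventually (Ioo_mem_nhds (by dsimp only; linarith)
      (by dsimp only; linarith))
  filter_upwards [h1] with x hx
  split_ifs with h
  · have e : x.2 = x.2 - n * T + T + (n - 1 : ℤ) * T := by push_cast; ring
    conv_rhs => rw [e]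
    rw [periodize_add_zsmul, periodize_eq hT h0 (by linarith) (by linarith)]
  · have e : x.2 = x.2 - n * T + n * T := by ring
    conv_rhs => rw [e]
    rw [periodize_add_zsmul, periodize_eq hT h0 (by linarith) (by linarith)]

end Periodize

/-! ### Local dilations into the surface and a criterion for the Veech group -/

namespace Disco

/-- With respect to `L`, the map `Q` into the surface is, along `l`, locally of the form
`z ↦ a z + b` with `a > 0` real, in affine coordinates near `s`. -/
def LocAff {X : Type*} (Q : X → Surface) (L : X → ℂ) (l : Filter X) (s : Surface) : Prop :=
  ∀ F : Surface → ℂ, (∀ q, proj q = s → PolyDil F q) →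
    ∃ a : ℝ, 0 < a ∧ ∃ b : ℂ, ∀ᶠ x in l, F (Q x) = a * L x + b

/-- Change of source: a map that factors through a known local dilation is one too, provided that
the two comparison functions differ by a positive scalar and a translation. Every later verification
is an instance of this. -/
theorem LocAff.of_comp {X Y : Type*} {Q : X → Surface} {L : X → ℂ} {l : Filter X} {s : Surface}
    (h : LocAff Q L l s) {Q' : Y → Surface} {L' : Y → ℂ} {l' : Filter Y} (f : Y → X)
    (hf : Tendsto f l' l) (hQ : ∀ᶠ y in l', Q' y = Q (f y)) {c : ℝ} (hc : 0 < c) {d : ℂ}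
    (hL : ∀ᶠ y in l', L (f y) = c * L' y + d) : LocAff Q' L' l' s := by
  intro F hF
  obtain ⟨a, ha, b, hab⟩ := h F hF
  refine ⟨a * c, mul_pos ha hc, a * d + b, ?_⟩
  filter_upwards [hf.eventually hab, hQ, hL] with y h1 h2 h3
  rw [h2, h1, h3]
  push_cast
  ring

/-- The rotation reads `z ↦ 6 + i - z` on the rectangle, so `F ∘ rotFun` has a negative factor. The
sign on `L` absorbs it, and the factor stays positive as required. -/
theorem LocAff.rot {X : Type*} {Q : X → Surface} {L : X → ℂ} {l : Filter X} {s : Surface}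
    (h : LocAff Q L l s) : LocAff (fun x => rotFun (Q x)) (fun x => -L x) l (rotFun s) := by
  intro F hF
  -- The test function is negated because `-F ∘ rotFun` is again a positive dilation on the
  -- rectangle.
  obtain ⟨a, ha, b, hab⟩ := h (fun y => -F (rotFun y)) (by
    intro q hq
    obtain ⟨a, ha, b, hab⟩ := hF (rotPolygon q) (by rw [← rotFun_proj, hq])
    refine ⟨a, ha, -(a * (6 + Complex.I) + b), ?_⟩
    filter_upwards [continuous_rotPolygon.continuousAt.eventually hab] with p' h
    rw [rotFun_proj, h, rotPolygon]
    ring)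
  refine ⟨a, ha, -b, ?_⟩
  filter_upwards [hab] with x hx
  linear_combination -hx

/-- The filter is restricted to the rectangle, since `clamp` is the identity only there. -/
theorem locAff_proj (z : ℂ) :
    LocAff (fun w => proj (clamp w)) id (𝓝[polygon] z) (proj (clamp z)) := by
  intro F hF
  obtain ⟨a, ha, b, hab⟩ := hF (clamp z) rfl
  refine ⟨a, ha, b, ?_⟩
  filter_upwards [(continuous_clamp.continuousAt.eventually hab).filter_mono nhdsWithin_le_nhds,
    self_mem_nhdsWithin] with w h hw
  rw [h, clamp_of_mem hw]
  rfl

theorem locAff_chart {φ : OpenPartialHomeomorph Surface ℂ} (hφ : φ ∈ atlas) {u : ℂ}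
    (hu : u ∈ φ.target) : LocAff φ.symm id (𝓝 u) (φ.symm u) := by
  intro F hF
  obtain ⟨a, ha, b, hab⟩ := isDilationAt_chart hφ (φ.map_target hu) hF
  refine ⟨a, ha, b, ?_⟩
  filter_upwards [(φ.continuousAt_symm hu).eventually hab, φ.open_target.mem_nhds hu] with w h hw
  rw [h, φ.right_inv hw]
  rfl

theorem continuous_mk : Continuous fun x : ℝ × ℝ => (⟨x.1, x.2⟩ : ℂ) :=
  Complex.equivRealProdCLM.symm.continuous

theorem continuous_matAct (M : Matrix (Fin 2) (Fin 2) ℝ) : Continuous (matAct M) := by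
  refine continuous_mk.comp (f := fun z : ℂ =>
    (M 0 0 * z.re + M 0 1 * z.im, M 1 0 * z.re + M 1 1 * z.im)) ?_
  fun_prop

/-- The condition is tested in the rectangle alone, at each preimage of a point separately, hence on
one-sided neighbourhoods at boundary points. That the constants found at glued points agree is part
of `isDilationAt_chart`. -/
theorem mem_veechGroup {f : Surface ≃ₜ Surface} {M : Matrix.SpecialLinearGroup (Fin 2) ℝ}
    (hs : f '' sing = sing) (h : ∀ p, f (proj p) ∉ sing →
      LocAff (fun p' => f (proj p')) (fun p' : polygon => matAct M.1 p'.1) (𝓝 p) (f (proj p))) :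
    M ∈ discoSurface.veechGroup := by
  have hM : discoSurface.HasNormalizedLinearPart f M := by
    intro φ hφ ψ hψ x hx hfx
    have hns := discoSurface.notMem_sing hψ hfx
    have h1 : ∀ N : Matrix.SpecialLinearGroup (Fin 2) ℝ, ∀ z,
        matAct N.1 (matAct (N⁻¹).1 z) = z := by
      intro N z
      rw [← matAct_mul, ← Matrix.SpecialLinearGroup.coe_mul, mul_inv_cancel,
        Matrix.SpecialLinearGroup.coe_one, matAct_one]
    obtain ⟨c, hc, b, hb⟩ := isDilationAt_chart hφ hx
      -- Undoing `M` after `f` leaves a function that should be a positive dilation of `φ`; this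
      -- reduces the claim about linear parts to one about dilations.
      (F := fun y => matAct (M⁻¹).1 (ψ (f y))) (by
        rintro p rfl
        obtain ⟨a, ha, b, hab⟩ := h p hns ψ fun q hq => atlas_polyDil hψ (by rwa [hq])
        refine ⟨a, ha, matAct (M⁻¹).1 b, ?_⟩
        filter_upwards [hab] with p' hp'
        have := h1 M⁻¹ p'.1
        rw [inv_inv] at this
        rw [hp', matAct_add, matAct_real_mul, this])
    refine ⟨c, hc, matAct M.1 b, ?_⟩
    filter_upwards [hb] with y hy
    rw [← h1 M (ψ (f y)), hy, matAct_add, matAct_real_mul, matAct_smul]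
  exact ⟨f, hM.isAffineAut hs, hM⟩

theorem image_sing_of_fixed {f : Surface → Surface} (h : ∀ p, IsVertex p → f (proj p) = proj p) :
    f '' sing = sing := by
  refine (image_congr ?_).trans (image_id _)
  rintro _ ⟨p, hp, rfl⟩
  exact h p hp

/-! ### Points of the surface by coordinates -/

/-- The point of the surface with given coordinates in the rectangle. -/
def pt (x y : ℝ) : Surface := proj (clamp ⟨x, y⟩)

theorem proj_eq_pt (p : polygon) : proj p = pt p.1.re p.1.im := by
  rw [pt, Complex.eta, clamp_coe]

theorem proj_clamp (z : ℂ) : proj (clamp z) = pt z.re z.im := rfl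

theorem continuous_pt : Continuous fun x : ℝ × ℝ => pt x.1 x.2 :=
  continuous_proj.comp (continuous_clamp.comp continuous_mk)

theorem pt_six (y : ℝ) : pt 6 y = pt 0 y := by
  symm
  refine Quot.sound (Or.inl ?_)
  simp [clamp]

theorem pt_glue₁ {x : ℝ} (h : 0 ≤ x) (h' : x ≤ 1) : pt x 1 = pt (2 * x + 1) 0 := by
  refine Quot.sound ?_
  rw [clamp_of_mem (mem_mk (by grind)), clamp_of_mem (mem_mk (by grind))]
  exact Or.inr ⟨rfl, rfl, Or.inl ⟨h, h', rfl⟩⟩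

/-- Parametrised by the bottom segment `[0, 1]`, so that this gluing and `pt_glue₁` use the same map
`x ↦ 2x + 1`: it is the change of scale between the two pieces of the vertical cylinder. -/
theorem pt_glue₂ {x : ℝ} (h : 0 ≤ x) (h' : x ≤ 1) : pt (2 * x + 1) 1 = pt x 0 := by
  refine Quot.sound ?_
  rw [clamp_of_mem (mem_mk (by grind)), clamp_of_mem (mem_mk (by grind))]
  refine Or.inr ⟨rfl, rfl, Or.inr (Or.inl ⟨?_, ?_, ?_⟩)⟩ <;> dsimp only <;> linarith

theorem rotFun_pt {x y : ℝ} (h : (0 ≤ x ∧ x ≤ 6) ∧ 0 ≤ y ∧ y ≤ 1) :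
    rotFun (pt x y) = pt (6 - x) (1 - y) := by
  rw [pt, clamp_of_mem (mem_mk h), rotFun_proj, proj_eq_pt, rotPolygon_re, rotPolygon_im]

theorem mem_sing_of_pt_mem {x y : ℝ} (h : (0 ≤ x ∧ x ≤ 6) ∧ 0 ≤ y ∧ y ≤ 1)
    (hy : y = 0 ∨ y = 1) (hx : x = 0 ∨ x = 1 ∨ x = 3 ∨ x = 5 ∨ x = 6) : pt x y ∈ sing := by
  rw [pt, clamp_of_mem (mem_mk h)]
  exact proj_mem_sing.2 ⟨hy, hx⟩

/-! ### The rotation by π -/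

theorem rot_mem_veechGroup {M : Matrix.SpecialLinearGroup (Fin 2) ℝ}
    (hM : M.1 = !![-1, 0; 0, -1]) : M ∈ discoSurface.veechGroup := by
  have hv : ∀ x ∈ sing, rotFun x ∈ sing := by
    rintro _ ⟨p, hp, rfl⟩
    exact proj_mem_sing.2 (isVertex_rot.2 hp)
  refine mem_veechGroup (f := rot) ?_ fun p hp => ?_
  · refine Subset.antisymm (by rintro _ ⟨x, hx, rfl⟩; exact hv x hx) fun x hx =>
      ⟨rotFun x, hv x hx, rotFun_rotFun x⟩
  · refine LocAff.of_comp (locAff_proj p.1).rot (fun p' : polygon => p'.1) ?_ ?_ one_pos (d := 0) ?_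
      |> (fun h => by rwa [clamp_coe] at h)
    · exact tendsto_nhdsWithin_iff.2 ⟨continuous_subtype_val.continuousAt,
        Eventually.of_forall fun p' => p'.2⟩
    · exact Eventually.of_forall fun p' => by rw [clamp_coe]; rfl
    · exact Eventually.of_forall fun p' => by
        rw [hM]; apply Complex.ext <;> simp [matAct]

/-! ### The horizontal twist -/

/-- The horizontal lines of the rectangle, as closed curves. -/
def hline (y x : ℝ) : Surface := periodize (by norm_num : (0 : ℝ) < 6) (fun y x => pt x y) y x

theorem continuous_hline : Continuous fun x : ℝ × ℝ => hline x.1 x.2 :=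
  continuous_periodize _ pt_six (continuous_pt.comp continuous_swap)

theorem hline_eq {y x : ℝ} (h : 0 ≤ x) (h' : x ≤ 6) : hline y x = pt x y :=
  periodize_eq _ pt_six h h'

theorem hline_add (y x : ℝ) (n : ℤ) : hline y (x + n * 6) = hline y x :=
  periodize_add_zsmul _ _ _ _

/-- The horizontal multitwist on the rectangle. -/
def horPolygon (n : ℤ) (p : polygon) : Surface := hline p.1.im (p.1.re + n * (6 * p.1.im))

/-- The displacement `6 * n * y` is `0` on the bottom and `n` full turns on the top. Compatibility
with the gluing of top and bottom is then automatic. -/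
theorem horPolygon_eq (n : ℤ) {p : polygon} (h : p.1.im = 0 ∨ p.1.im = 1) :
    horPolygon n p = proj p := by
  obtain ⟨⟨h1, h2⟩, _⟩ := p.2
  rw [horPolygon, proj_eq_pt, ← hline_eq h1 h2]
  rcases h with h | h <;> rw [h]
  · simp
  · rw [mul_one, hline_add]

theorem horPolygon_glue (n : ℤ) (p q : polygon) (h : Glue p q) :
    horPolygon n p = horPolygon n q := by
  have h' := h
  rcases h with ⟨h1, h2, h3⟩ | ⟨h1, h2, _⟩
  · rw [horPolygon, horPolygon, h1, h2, h3]
    -- The two lateral points lie on one horizontal line, exactly one period apart, and are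
    -- displaced equally.
    have := hline_add p.1.im (0 + n * (6 * p.1.im)) 1
    rw [← this]
    congr 1
    push_cast
    ring
  · rw [horPolygon_eq n (Or.inr h1), horPolygon_eq n (Or.inl h2)]
    exact Quot.sound h'

/-- The horizontal multitwist. -/
def horFun (n : ℤ) : Surface → Surface := Quot.lift (horPolygon n) (horPolygon_glue n)

theorem horFun_proj (n : ℤ) (p : polygon) : horFun n (proj p) = horPolygon n p := rfl

theorem continuous_horFun (n : ℤ) : Continuous (horFun n) := by
  refine continuous_quot_lift _ (continuous_hline.comp
    (g := fun x : ℝ × ℝ => hline x.1 x.2) (f := fun p : polygon =>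
      (p.1.im, p.1.re + n * (6 * p.1.im))) ?_)
  fun_prop

/-- In the periodic coordinate the twist is a translation on each line, for every real `x`; this
makes the twists for `n` and `-n` inverse to each other. -/
theorem horFun_hline (n : ℤ) {y : ℝ} (h : 0 ≤ y) (h' : y ≤ 1) (x : ℝ) :
    horFun n (hline y x) = hline y (x + n * (6 * y)) := by
  obtain ⟨m, r, hr, hr', rfl⟩ := exists_eq_add_period (by norm_num : (0 : ℝ) < 6) x
  rw [hline_add, hline_eq hr hr'.le, pt, clamp_of_mem (mem_mk ⟨⟨hr, hr'.le⟩, h, h'⟩),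
    horFun_proj, horPolygon, add_right_comm, hline_add]

theorem horFun_neg_horFun (n : ℤ) (x : Surface) : horFun (-n) (horFun n x) = x := by
  obtain ⟨p, rfl⟩ := surjective_proj x
  obtain ⟨⟨h1, h2⟩, h3, h4⟩ := p.2
  rw [horFun_proj, horPolygon, horFun_hline _ h3 h4, proj_eq_pt, ← hline_eq h1 h2]
  congr 1
  push_cast
  ring

/-- The horizontal multitwist, as a homeomorphism. -/
def hor (n : ℤ) : Surface ≃ₜ Surface where
  toFun := horFun n
  invFun := horFun (-n)
  left_inv := horFun_neg_horFun n
  right_inv x := by simpa using horFun_neg_horFun (-n) x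
  continuous_toFun := continuous_horFun n
  continuous_invFun := continuous_horFun (-n)

theorem hor_apply (n : ℤ) (p : polygon) : hor n (proj p) = horPolygon n p := rfl

/-! ### Linear part of the horizontal twist -/

/-- The horizontal strip that projects onto the surface. -/
def strip : Set ℂ := {z | 0 ≤ z.im ∧ z.im ≤ 1}

theorem locAff_hline_of_mem {z : ℂ} (hz : 0 ≤ z.im ∧ z.im ≤ 1) (h : 0 ≤ z.re) (h' : z.re < 6)
    (hs : hline z.im z.re ∉ sing) :
    LocAff (fun w => hline w.im w.re) id (𝓝[strip] z) (hline z.im z.re) := by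
  rw [hline_eq h h'.le] at hs ⊢
  rcases h.eq_or_lt with h | h
  -- On the seam `re = 0` both ends are vertices, so a nonsingular point has `0 < im < 1` and the
  -- lateral chart describes the strip on both sides of the seam.
  · have h0 : 0 < z.im := hz.1.lt_of_ne fun e =>
      hs (mem_sing_of_pt_mem ⟨⟨h.le, h'.le⟩, hz⟩ (Or.inl e.symm) (Or.inl h.symm))
    have h1 : z.im < 1 := hz.2.lt_of_ne fun e =>
      hs (mem_sing_of_pt_mem ⟨⟨h.le, h'.le⟩, hz⟩ (Or.inr e) (Or.inl h.symm))
    have key : ∀ w ∈ lateralPieces.chart.target,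
        hline w.im w.re = lateralPieces.chart.symm w := by
      intro w hw
      obtain ⟨⟨h1, h2⟩, h3, h4⟩ := id hw
      rcases le_total 0 w.re with h5 | h5
      · exact (hline_eq h5 (by linarith)).trans
          (lateralPieces.invFun_eq hw (i := false) h5).symm
      · have e := hline_add w.im w.re 1
        refine e.symm.trans ((hline_eq (by push_cast; linarith) (by push_cast; linarith)).trans
          (Eq.trans ?_ (lateralPieces.invFun_eq hw (i := true) h5).symm))
        simp [lateralPieces, proj_clamp]
    have hzt : z ∈ lateralPieces.chart.target := ⟨⟨by linarith, by linarith⟩, h0, h1⟩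
    have := locAff_chart (φ := lateralPieces.chart) (by simp [atlas]) hzt
    rw [← hline_eq h.le h'.le, key z hzt]
    refine this.of_comp id nhdsWithin_le_nhds ?_ one_pos (d := 0) (by simp)
    filter_upwards [mem_nhdsWithin_of_mem_nhds
      (lateralPieces.chart.open_target.mem_nhds hzt)] with w hw using key w hw
  -- Off the seam, the strip near `z` lies in the rectangle, even when `z` is on its top or bottom.
  · have hzp : z ∈ polygon := ⟨⟨h.le, h'.le⟩, hz⟩
    have hev : ∀ᶠ w in 𝓝[strip] z, w ∈ polygon := by
      filter_upwards [self_mem_nhdsWithin, mem_nhdsWithin_of_mem_nhds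
        (Complex.continuous_re.continuousAt.eventually (Ioo_mem_nhds h h'))] with w h1 h2
      exact ⟨⟨h2.1.le, h2.2.le⟩, h1⟩
    refine (locAff_proj z).of_comp id (tendsto_nhdsWithin_iff.2 ⟨nhdsWithin_le_nhds, hev⟩) ?_
      one_pos (d := 0) (by simp)
    filter_upwards [hev] with w hw using hline_eq hw.1.1 hw.1.2

/-- A translation by a multiple of 6 brings `z` to the fundamental domain and is invisible to local
dilations. -/
theorem locAff_hline {z : ℂ} (hz : 0 ≤ z.im ∧ z.im ≤ 1) (hs : hline z.im z.re ∉ sing) :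
    LocAff (fun w => hline w.im w.re) id (𝓝[strip] z) (hline z.im z.re) := by
  obtain ⟨m, r, hr, hr', h⟩ := exists_eq_add_period (by norm_num : (0 : ℝ) < 6) z.re
  have e : ∀ w : ℂ, hline w.im w.re = hline (w - m * 6).im (w - m * 6).re := by
    intro w
    rw [← hline_add _ (w - m * 6).re m]
    simp
  have e1 : (z - m * 6).re = r := by simp [h]
  have e2 : (z - m * 6).im = z.im := by simp
  have := locAff_hline_of_mem (z := z - m * 6) (by rwa [e2]) (by rwa [e1]) (by rwa [e1])
    (by rwa [← e])
  rw [e z]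
  refine this.of_comp (fun w => w - m * 6) ?_ (Eventually.of_forall e) one_pos (d := -(m * 6))
    (Eventually.of_forall fun w => by simp [sub_eq_add_neg])
  refine tendsto_nhdsWithin_iff.2 ⟨?_, ?_⟩
  · exact ((continuous_sub_right _).tendsto z).mono_left nhdsWithin_le_nhds
  · filter_upwards [self_mem_nhdsWithin] with w hw
    simpa [strip] using hw

theorem hor_mem_veechGroup {M : Matrix.SpecialLinearGroup (Fin 2) ℝ}
    (hM : M.1 = !![1, 6; 0, 1]) : M ∈ discoSurface.veechGroup := by
  refine mem_veechGroup (f := hor 1) (image_sing_of_fixed fun p hp => horPolygon_eq 1 hp.1)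
    fun p hp => ?_
  -- The twist is the linear map `M` followed by the projection of the strip; `M` preserves
  -- imaginary parts, hence the strip.
  have e : ∀ p' : polygon, hor 1 (proj p') =
      hline (matAct M.1 p'.1).im (matAct M.1 p'.1).re := by
    intro p'
    rw [hor_apply, horPolygon, hM]
    simp [matAct]
  have him : ∀ p' : polygon, (matAct M.1 p'.1).im = p'.1.im := by
    intro p'; rw [hM]; simp [matAct]
  rw [e] at hp ⊢
  refine (locAff_hline (by rw [him]; exact p.2.2) hp).of_comp (fun p' => matAct M.1 p'.1) ?_
    (Eventually.of_forall e) one_pos (d := 0) (by simp)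
  refine tendsto_nhdsWithin_iff.2 ⟨?_, Eventually.of_forall fun p' => ?_⟩
  · exact ((continuous_matAct _).comp continuous_subtype_val).continuousAt
  · rw [strip, mem_ofPred_eq, him]; exact p'.2.2

/-! ### The vertical cylinder in the left half -/

/-- The vertical lines of the cylinder `[0, 3] × [0, 1]`, as closed curves, on a fundamental
domain. -/
def vlineBase (x t : ℝ) : Surface :=
  if t ≤ 1 then pt (max 0 (min 1 x)) t else pt (2 * max 0 (min 1 x) + 1) (2 * (t - 1))

/-- At height 3/2 the curve reaches the top of `[1, 3]`, which is glued back to the bottom of `[0,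
1]`. Clamping `x` to `[0, 1]` in `vlineBase` makes this true for all real `x`, as the periodic
extension of a family over `ℝ` demands. -/
theorem vlineBase_period (x : ℝ) : vlineBase x (3 / 2) = vlineBase x 0 := by
  rw [vlineBase, vlineBase, if_neg (by norm_num), if_pos (by norm_num),
    ← pt_glue₂ (le_max_left _ _) (max_le zero_le_one (min_le_left _ _))]
  norm_num

theorem continuous_vlineBase : Continuous fun x : ℝ × ℝ => vlineBase x.1 x.2 := by
  refine Continuous.if_le ?_ ?_ continuous_snd continuous_const ?_
  · exact continuous_pt.comp (f := fun x : ℝ × ℝ => (max 0 (min 1 x.1), x.2)) (by fun_prop)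
  · exact continuous_pt.comp
      (f := fun x : ℝ × ℝ => (2 * max 0 (min 1 x.1) + 1, 2 * (x.2 - 1))) (by fun_prop)
  · intro x hx
    rw [hx, pt_glue₁ (le_max_left _ _) (max_le zero_le_one (min_le_left _ _)), sub_self, mul_zero]

/-- The vertical lines of the cylinder `[0, 3] × [0, 1]`, as closed curves. -/
def vline (x t : ℝ) : Surface := periodize (by norm_num : (0 : ℝ) < 3 / 2) vlineBase x t

theorem continuous_vline : Continuous fun x : ℝ × ℝ => vline x.1 x.2 :=
  continuous_periodize _ vlineBase_period continuous_vlineBase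

theorem vline_add (x t : ℝ) (n : ℤ) : vline x (t + n * (3 / 2)) = vline x t :=
  periodize_add_zsmul _ _ _ _

theorem vline_eq₁ {x t : ℝ} (hx : 0 ≤ x) (hx' : x ≤ 1) (h : 0 ≤ t) (h' : t ≤ 1) :
    vline x t = pt x t := by
  rw [vline, periodize_eq _ vlineBase_period h (by linarith), vlineBase, if_pos h',
    min_eq_right hx', max_eq_right hx]

theorem vline_eq₂ {x t : ℝ} (hx : 0 ≤ x) (hx' : x ≤ 1) (h : 1 ≤ t) (h' : t ≤ 3 / 2) :
    vline x t = pt (2 * x + 1) (2 * (t - 1)) := by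
  rcases h.eq_or_lt with rfl | h
  · rw [vline_eq₁ hx hx' zero_le_one le_rfl, pt_glue₁ hx hx', sub_self, mul_zero]
  · rw [vline, periodize_eq _ vlineBase_period (by linarith) h', vlineBase, if_neg h.not_ge,
      min_eq_right hx', max_eq_right hx]

/-- The vertical twist on the half `[0, 3] × [0, 1]` of the rectangle. -/
def verHalf (n : ℤ) (p : polygon) : Surface :=
  if p.1.re ≤ 1 then vline p.1.re (p.1.im + n * (3 / 2 * p.1.re))
  else vline ((p.1.re - 1) / 2) (1 + p.1.im / 2 + n * (3 / 2 * ((p.1.re - 1) / 2)))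

/-- The edge `re = 1` is the right boundary of the first piece, where the twist makes `n` full
turns, and the left boundary of the second, where it does not move. Both formulas thus fix it
pointwise. -/
theorem verHalf_aux (n : ℤ) {p : polygon} (h : p.1.re = 1) :
    vline p.1.re (p.1.im + n * (3 / 2 * p.1.re)) = pt 1 p.1.im ∧
    vline ((p.1.re - 1) / 2) (1 + p.1.im / 2 + n * (3 / 2 * ((p.1.re - 1) / 2))) =
      pt 1 p.1.im := by
  obtain ⟨_, h3, h4⟩ := p.2
  constructor
  · rw [h, mul_one, vline_add, vline_eq₁ zero_le_one le_rfl h3 h4]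
  · rw [h, sub_self, zero_div, mul_zero, mul_zero, add_zero,
      vline_eq₂ le_rfl zero_le_one (by linarith) (by linarith)]
    congr 1 <;> ring

theorem verHalf_eq₁ (n : ℤ) {p : polygon} (h : p.1.re ≤ 1) :
    verHalf n p = vline p.1.re (p.1.im + n * (3 / 2 * p.1.re)) := if_pos h

theorem verHalf_eq₂ (n : ℤ) {p : polygon} (h : 1 ≤ p.1.re) :
    verHalf n p =
      vline ((p.1.re - 1) / 2) (1 + p.1.im / 2 + n * (3 / 2 * ((p.1.re - 1) / 2))) := by
  rcases h.eq_or_lt with h | h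
  · rw [verHalf_eq₁ n h.symm.le, (verHalf_aux n h.symm).1, (verHalf_aux n h.symm).2]
  · exact if_neg h.not_ge

theorem continuous_verHalf (n : ℤ) : Continuous (verHalf n) := by
  refine Continuous.if_le ?_ ?_ (by fun_prop) continuous_const ?_
  · exact continuous_vline.comp
      (f := fun p : polygon => (p.1.re, p.1.im + n * (3 / 2 * p.1.re))) (by fun_prop)
  · exact continuous_vline.comp (f := fun p : polygon => ((p.1.re - 1) / 2,
      1 + p.1.im / 2 + n * (3 / 2 * ((p.1.re - 1) / 2)))) (by fun_prop)
  · intro p hp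
    exact (verHalf_aux n hp).1.trans (verHalf_aux n hp).2.symm

theorem verHalf_edge (n : ℤ) {p : polygon} (h : p.1.re = 0 ∨ p.1.re = 1 ∨ p.1.re = 3) :
    verHalf n p = proj p := by
  obtain ⟨_, h3, h4⟩ := p.2
  rw [proj_eq_pt]
  rcases h with h | h | h
  · rw [verHalf_eq₁ n (by linarith), h, mul_zero, mul_zero, add_zero,
      vline_eq₁ le_rfl zero_le_one h3 h4]
  · rw [verHalf_eq₁ n h.le, (verHalf_aux n h).1, h]
  · rw [verHalf_eq₂ n (by linarith), h]
    norm_num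
    rw [vline_add, vline_eq₂ zero_le_one le_rfl (by linarith) (by linarith)]
    congr 1 <;> ring

/-- Glued points share the cylinder coordinate `x`. Their heights coincide for the first gluing and
differ by the period 3/2 for the second. -/
theorem verHalf_glue (n : ℤ) {p q : polygon} (hp : p.1.im = 1) (hq : q.1.im = 0)
    (h : (0 ≤ p.1.re ∧ p.1.re ≤ 1 ∧ q.1.re = 2 * p.1.re + 1) ∨
      (1 ≤ p.1.re ∧ p.1.re ≤ 3 ∧ q.1.re = (p.1.re - 1) / 2)) : verHalf n p = verHalf n q := by
  rcases h with ⟨h1, h2, h3⟩ | ⟨h1, h2, h3⟩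
  · rw [verHalf_eq₁ n h2, verHalf_eq₂ n (by linarith), hp, hq, h3]
    congr 1 <;> ring
  · rw [verHalf_eq₂ n h1, verHalf_eq₁ n (by linarith), hp, hq, h3, ← vline_add _ (0 + _) 1]
    congr 1
    push_cast
    ring

/-! ### The vertical twist on the whole surface -/

/-- The vertical twist on the rectangle. -/
def verPolygon (n : ℤ) (p : polygon) : Surface :=
  if p.1.re ≤ 3 then verHalf n p else rotFun (verHalf n (rotPolygon p))

theorem verPolygon_aux (n : ℤ) {p : polygon} (h : p.1.re = 3) :
    verHalf n p = rotFun (verHalf n (rotPolygon p)) := by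
  rw [verHalf_edge n (Or.inr (Or.inr h)),
    verHalf_edge n (Or.inr (Or.inr (by rw [rotPolygon_re, h]; norm_num))), rotFun_proj,
    rotPolygon_rotPolygon]

theorem verPolygon_eq₁ (n : ℤ) {p : polygon} (h : p.1.re ≤ 3) : verPolygon n p = verHalf n p :=
  if_pos h

theorem verPolygon_eq₂ (n : ℤ) {p : polygon} (h : 3 ≤ p.1.re) :
    verPolygon n p = rotFun (verHalf n (rotPolygon p)) := by
  rcases h.eq_or_lt with h | h
  · rw [verPolygon_eq₁ n h.symm.le, verPolygon_aux n h.symm]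
  · exact if_neg h.not_ge

theorem continuous_verPolygon (n : ℤ) : Continuous (verPolygon n) := by
  refine Continuous.if_le (continuous_verHalf n)
    (continuous_rotFun.comp ((continuous_verHalf n).comp continuous_rotPolygon))
    (by fun_prop) continuous_const ?_
  exact fun p hp => verPolygon_aux n hp

theorem verPolygon_rot (n : ℤ) (p : polygon) :
    verPolygon n (rotPolygon p) = rotFun (verPolygon n p) := by
  rcases le_total p.1.re 3 with h | h
  · rw [verPolygon_eq₁ n h, verPolygon_eq₂ n (by rw [rotPolygon_re]; linarith),
      rotPolygon_rotPolygon]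
  · rw [verPolygon_eq₂ n h, verPolygon_eq₁ n (by rw [rotPolygon_re]; linarith), rotFun_rotFun]

theorem verPolygon_edge (n : ℤ) {p : polygon}
    (h : p.1.re = 0 ∨ p.1.re = 1 ∨ p.1.re = 3 ∨ p.1.re = 5 ∨ p.1.re = 6) :
    verPolygon n p = proj p := by
  rcases le_total p.1.re 3 with h' | h'
  · rw [verPolygon_eq₁ n h', verHalf_edge n (by grind)]
  · rw [verPolygon_eq₂ n h', verHalf_edge n (by rw [rotPolygon_re]; grind), rotFun_proj,
      rotPolygon_rotPolygon]

theorem verPolygon_glue (n : ℤ) (p q : polygon) (h : Glue p q) :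
    verPolygon n p = verPolygon n q := by
  have key : ∀ p q : polygon, p.1.im = 1 → q.1.im = 0 →
      ((0 ≤ p.1.re ∧ p.1.re ≤ 1 ∧ q.1.re = 2 * p.1.re + 1) ∨
        (1 ≤ p.1.re ∧ p.1.re ≤ 3 ∧ q.1.re = (p.1.re - 1) / 2)) →
      verPolygon n p = verPolygon n q := by
    intro p q hp hq h
    rw [verPolygon_eq₁ n (by grind), verPolygon_eq₁ n (by grind), verHalf_glue n hp hq h]
  -- The gluings of the right half are the rotated gluings of the left half, with the roles of top
  -- and bottom exchanged.
  have key' : (rotPolygon q).1.im = 1 → (rotPolygon p).1.im = 0 →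
      ((0 ≤ (rotPolygon q).1.re ∧ (rotPolygon q).1.re ≤ 1 ∧
          (rotPolygon p).1.re = 2 * (rotPolygon q).1.re + 1) ∨
        (1 ≤ (rotPolygon q).1.re ∧ (rotPolygon q).1.re ≤ 3 ∧
          (rotPolygon p).1.re = ((rotPolygon q).1.re - 1) / 2)) →
      verPolygon n p = verPolygon n q := by
    intro h1 h2 h3
    have := congrArg rotFun (key _ _ h1 h2 h3)
    rwa [verPolygon_rot, verPolygon_rot, rotFun_rotFun, rotFun_rotFun, eq_comm] at this
  have hs : proj p = proj q := Quot.sound h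
  simp only [rotPolygon_re, rotPolygon_im] at key'
  rcases h with ⟨h1, h2, _⟩ | ⟨h1, h2, h | h | h | h⟩
  -- The lateral sides are fixed pointwise, so their gluing is respected.
  · rw [verPolygon_edge n (by grind), verPolygon_edge n (by grind), hs]
  · exact key p q h1 h2 (Or.inl h)
  · exact key p q h1 h2 (Or.inr h)
  · exact key' (by linarith) (by linarith) (Or.inl (by grind))
  · exact key' (by linarith) (by linarith) (Or.inr (by grind))

/-- The vertical twist. -/
def verFun (n : ℤ) : Surface → Surface := Quot.lift (verPolygon n) (verPolygon_glue n)

theorem verFun_proj (n : ℤ) (p : polygon) : verFun n (proj p) = verPolygon n p := rfl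

theorem continuous_verFun (n : ℤ) : Continuous (verFun n) :=
  continuous_quot_lift _ (continuous_verPolygon n)

theorem verFun_rotFun (n : ℤ) (x : Surface) : verFun n (rotFun x) = rotFun (verFun n x) := by
  obtain ⟨p, rfl⟩ := surjective_proj x
  exact verPolygon_rot n p

theorem verFun_pt (n : ℤ) {x y : ℝ} (h : (0 ≤ x ∧ x ≤ 6) ∧ 0 ≤ y ∧ y ≤ 1) :
    verFun n (pt x y) = verPolygon n ⟨⟨x, y⟩, mem_mk h⟩ := by
  rw [pt, clamp_of_mem (mem_mk h), verFun_proj]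

/-- The vertical counterpart of `horFun_hline`: one formula covers both pieces of the cylinder, so
twists compose by adding displacements. -/
theorem verFun_vline (n : ℤ) {x : ℝ} (h : 0 ≤ x) (h' : x ≤ 1) (t : ℝ) :
    verFun n (vline x t) = vline x (t + n * (3 / 2 * x)) := by
  obtain ⟨m, r, hr, hr', rfl⟩ := exists_eq_add_period (by norm_num : (0 : ℝ) < 3 / 2) t
  rw [vline_add, add_right_comm, vline_add]
  rcases le_total r 1 with h1 | h1
  · rw [vline_eq₁ h h' hr h1, verFun_pt n ⟨⟨h, by linarith⟩, hr, h1⟩,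
      verPolygon_eq₁ n (by dsimp only; linarith), verHalf_eq₁ n h']
  · rw [vline_eq₂ h h' h1 hr'.le,
      verFun_pt n ⟨⟨by linarith, by linarith⟩, by linarith, by linarith⟩,
      verPolygon_eq₁ n (by dsimp only; linarith), verHalf_eq₂ n (by dsimp only; linarith)]
    dsimp only
    congr 1 <;> ring

theorem exists_proj_eq_vline {p : polygon} (h : p.1.re ≤ 3) :
    ∃ x t, 0 ≤ x ∧ x ≤ 1 ∧ proj p = vline x t := by
  obtain ⟨⟨h1, h2⟩, h3, h4⟩ := p.2
  rcases le_total p.1.re 1 with h' | h'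
  · exact ⟨_, _, h1, h', by rw [vline_eq₁ h1 h' h3 h4, proj_eq_pt]⟩
  · refine ⟨(p.1.re - 1) / 2, 1 + p.1.im / 2, by linarith, by linarith, ?_⟩
    rw [vline_eq₂ (by linarith) (by linarith) (by linarith) (by linarith), proj_eq_pt]
    congr 1 <;> ring

theorem verFun_neg_verFun (n : ℤ) (x : Surface) : verFun (-n) (verFun n x) = x := by
  have key : ∀ p : polygon, p.1.re ≤ 3 → verFun (-n) (verFun n (proj p)) = proj p := by
    intro p hp
    obtain ⟨x, t, hx, hx', h⟩ := exists_proj_eq_vline hp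
    rw [h, verFun_vline n hx hx', verFun_vline _ hx hx']
    congr 1
    push_cast
    ring
  obtain ⟨p, rfl⟩ := surjective_proj x
  rcases le_total p.1.re 3 with h | h
  · exact key p h
  · have := congrArg rotFun (key (rotPolygon p) (by rw [rotPolygon_re]; linarith))
    rwa [← verFun_rotFun, ← verFun_rotFun, rotFun_proj, rotPolygon_rotPolygon] at this

/-- The vertical twist, as a homeomorphism. -/
def ver (n : ℤ) : Surface ≃ₜ Surface where
  toFun := verFun n
  invFun := verFun (-n)
  left_inv := verFun_neg_verFun n
  right_inv x := by simpa using verFun_neg_verFun (-n) x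
  continuous_toFun := continuous_verFun n
  continuous_invFun := continuous_verFun (-n)

theorem ver_apply (n : ℤ) (p : polygon) : ver n (proj p) = verPolygon n p := rfl

/-! ### Linear part of the vertical twist -/

theorem locAff_vline_of_mem {z : ℂ} (hz : 0 < z.re ∧ z.re < 1) (h : 0 ≤ z.im)
    (h' : z.im < 3 / 2) :
    LocAff (fun w => vline w.re w.im) id (𝓝 z) (vline z.re z.im) := by
  rcases h.eq_or_lt with h | h
  -- The seam at height `0` is where the top of `[1, 3]` meets the bottom of `[0, 1]`, which `edge₂`
  -- covers. That chart is at the scale of `[1, 3]`, twice the scale of the cylinder, and `2w + 1 +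
  -- i` carries the seam to the top side of `[1, 3]`.
  · have key : ∀ w : ℂ, 2 * w + (1 + Complex.I) ∈ edge₂.chart.target →
        vline w.re w.im = edge₂.chart.symm (2 * w + (1 + Complex.I)) := by
      intro w hw
      obtain ⟨⟨h1, h2⟩, h3, h4⟩ := id hw
      simp at h1 h2 h3 h4
      rcases le_total w.im 0 with h5 | h5
      · rw [← vline_add _ _ 1]
        refine (vline_eq₂ (by linarith) (by linarith) (by push_cast; linarith)
          (by push_cast; linarith)).trans (Eq.trans ?_ (edge₂.invFun_eq hw (i := false) ?_).symm)
        · simp [edge₂, edgePieces, proj_clamp]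
          congr 1
          ring
        · simp [edge₂, edgePieces]
          linarith
      · refine (vline_eq₁ (by linarith) (by linarith) h5 (by linarith)).trans
          (Eq.trans ?_ (edge₂.invFun_eq hw (i := true) ?_).symm)
        · simp [edge₂, edgePieces, proj_clamp]
        · simpa [edge₂, edgePieces] using h5
    have hzt : 2 * z + (1 + Complex.I) ∈ edge₂.chart.target := by
      refine ⟨⟨?_, ?_⟩, ?_, ?_⟩ <;> simp [← h] <;> linarith
    have hc : ContinuousAt (fun w : ℂ => 2 * w + (1 + Complex.I)) z := by fun_prop
    have := locAff_chart (φ := edge₂.chart) (by simp [atlas]) hzt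
    rw [key z hzt]
    refine this.of_comp (fun w : ℂ => 2 * w + (1 + Complex.I)) hc ?_ (c := 2) two_pos
      (d := 1 + Complex.I) (by simp)
    filter_upwards [hc.eventually (edge₂.chart.open_target.mem_nhds hzt)] with w hw using key w hw
  -- The chart `edge₁` unrolls the square and the halved second rectangle above it, so its target,
  -- of height 1 + 1/2, is the whole open fundamental domain.
  · have key : ∀ w ∈ edge₁.chart.target, vline w.re w.im = edge₁.chart.symm w := by
      intro w hw
      obtain ⟨⟨h1, h2⟩, h3, h4⟩ := id hw
      rcases le_total w.im 1 with h5 | h5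
      · exact (vline_eq₁ h1.le h2.le h3.le h5).trans (edge₁.invFun_eq hw (i := false) h5).symm
      · refine (vline_eq₂ h1.le h2.le h5 (by linarith)).trans
          (Eq.trans ?_ (edge₁.invFun_eq hw (i := true) h5).symm)
        simp [edge₁, edgePieces, proj_clamp]
    have hzt : z ∈ edge₁.chart.target := ⟨hz, h, by linarith⟩
    have := locAff_chart (φ := edge₁.chart) (by simp [atlas]) hzt
    rw [key z hzt]
    refine this.of_comp id tendsto_id ?_ one_pos (d := 0) (by simp)
    filter_upwards [edge₁.chart.open_target.mem_nhds hzt] with w hw using key w hw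

theorem locAff_vline {z : ℂ} (hz : 0 < z.re ∧ z.re < 1) :
    LocAff (fun w => vline w.re w.im) id (𝓝 z) (vline z.re z.im) := by
  obtain ⟨m, r, hr, hr', h⟩ := exists_eq_add_period (by norm_num : (0 : ℝ) < 3 / 2) z.im
  have e2 : ∀ w : ℂ, (w - (m * (3 / 2) : ℝ) * Complex.I).im = w.im - m * (3 / 2) := by
    intro w; simp
  have e1 : ∀ w : ℂ, (w - (m * (3 / 2) : ℝ) * Complex.I).re = w.re := by
    intro w; simp
  have e : ∀ w : ℂ, vline w.re w.im = vline (w - (m * (3 / 2) : ℝ) * Complex.I).re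
      (w - (m * (3 / 2) : ℝ) * Complex.I).im := by
    intro w
    rw [e1, e2, ← vline_add _ (_ - _) m, sub_add_cancel]
  have := locAff_vline_of_mem (z := z - (m * (3 / 2) : ℝ) * Complex.I) (by rwa [e1])
    (by rw [e2]; linarith) (by rw [e2]; linarith)
  rw [e z]
  exact this.of_comp (fun w => w - (m * (3 / 2) : ℝ) * Complex.I)
    ((continuous_sub_right _).tendsto z) (Eventually.of_forall e) one_pos
    (d := -((m * (3 / 2) : ℝ) * Complex.I))
    (Eventually.of_forall fun w => by simp [sub_eq_add_neg])

/-- The edges lie on the boundary of the cylinders, where `locAff_vline` says nothing. On either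
side the twist is the shear fixing the edge, up to a whole period, and the bounds on the sheared
height keep the image in the rectangle. -/
theorem verPolygon_near_edge {e : ℝ} (he : e = 0 ∨ e = 1 ∨ e = 3) {p : polygon}
    (h1 : e - 1 ≤ p.1.re) (h2 : p.1.re ≤ e + 1) (h3 : 0 ≤ p.1.im + 3 / 2 * (p.1.re - e))
    (h4 : p.1.im + 3 / 2 * (p.1.re - e) ≤ 1) :
    verPolygon 1 p = pt p.1.re (p.1.im + 3 / 2 * (p.1.re - e)) := by
  -- To the left of `e` the edge is the right boundary of its piece, so the twist exceeds the shear
  -- by one full turn. The right side of `e = 3` also reduces to this case, by rotation.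
  have left : ∀ {p : polygon}, e - 1 ≤ p.1.re → p.1.re ≤ e → 1 ≤ e →
      0 ≤ p.1.im + 3 / 2 * (p.1.re - e) → p.1.im + 3 / 2 * (p.1.re - e) ≤ 1 →
      verHalf 1 p = pt p.1.re (p.1.im + 3 / 2 * (p.1.re - e)) := by
    intro p h1 h2 he1 h3 h4
    obtain ⟨⟨h5, h6⟩, h7, h8⟩ := p.2
    rcases he with rfl | rfl | rfl
    · linarith
    · rw [verHalf_eq₁ 1 h2, ← vline_eq₁ h5 h2 h3 h4, ← vline_add _ (_ + 3 / 2 * _) 1]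
      congr 1
      push_cast
      ring
    · rw [verHalf_eq₂ 1 (by linarith),
        show 1 + p.1.im / 2 + (1 : ℤ) * (3 / 2 * ((p.1.re - 1) / 2)) =
          1 + p.1.im / 2 + 3 / 2 * ((p.1.re - 3) / 2) + (1 : ℤ) * (3 / 2) by push_cast; ring,
        vline_add, vline_eq₂ (by linarith) (by linarith) (by linarith) (by linarith)]
      congr 1 <;> ring
  obtain ⟨⟨h5, h6⟩, h7, h8⟩ := p.2
  rcases he' : he with rfl | rfl | rfl
  · rw [verPolygon_eq₁ 1 (by linarith), verHalf_eq₁ 1 (by linarith), ← vline_eq₁ h5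
      (by linarith) h3 h4]
    congr 1
    push_cast
    ring
  · rw [verPolygon_eq₁ 1 (by linarith)]
    rcases le_total p.1.re 1 with h | h
    · exact left h1 h le_rfl h3 h4
    · rw [verHalf_eq₂ 1 h, vline_eq₂ (by linarith) (by linarith)
        (by push_cast; linarith) (by push_cast; linarith)]
      congr 1
      · ring
      · push_cast; ring
  · rcases le_total p.1.re 3 with h | h
    · rw [verPolygon_eq₁ 1 h]
      exact left h1 h (by norm_num) h3 h4
    · have hr := rotPolygon_re p
      have hi := rotPolygon_im p
      rw [verPolygon_eq₂ 1 h, left (by linarith) (by linarith) (by norm_num) (by linarith)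
        (by linarith), rotFun_pt ⟨⟨by linarith, by linarith⟩, by linarith, by linarith⟩, hr, hi]
      congr 1 <;> ring

theorem matAct_vertical (z : ℂ) :
    matAct !![1, 0; 3 / 2, 1] z = ⟨z.re, 3 / 2 * z.re + z.im⟩ := by
  simp [matAct]

theorem locAff_verPolygon_edge {p : polygon} (he : p.1.re = 0 ∨ p.1.re = 1 ∨ p.1.re = 3)
    (hp : verPolygon 1 p ∉ sing) :
    LocAff (verPolygon 1) (fun p' : polygon => matAct !![1, 0; 3 / 2, 1] p'.1) (𝓝 p)
      (verPolygon 1 p) := by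
  rw [verPolygon_edge 1 (by tauto)] at hp ⊢
  rw [proj_mem_sing] at hp
  obtain ⟨_, h3, h4⟩ := p.2
  -- The ends of the edge are vertices, so a nonsingular point is interior to the edge, and the
  -- shear keeps its small neighbourhoods inside the rectangle.
  have h0 : 0 < p.1.im := h3.lt_of_ne fun h => hp ⟨Or.inl h.symm, by tauto⟩
  have h1 : p.1.im < 1 := h4.lt_of_ne fun h => hp ⟨Or.inr h, by tauto⟩
  set e := p.1.re with hee
  let f : polygon → ℂ := fun p' => ⟨p'.1.re, p'.1.im + 3 / 2 * (p'.1.re - e)⟩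
  have hf : Continuous f := continuous_mk.comp
    (f := fun p' : polygon => (p'.1.re, p'.1.im + 3 / 2 * (p'.1.re - e))) (by fun_prop)
  have hfp : f p = p.1 := by apply Complex.ext <;> simp [f, hee]
  have hre : ContinuousAt (fun p' : polygon => p'.1.re) p := by fun_prop
  have him : ContinuousAt (fun p' : polygon => p'.1.im + 3 / 2 * (p'.1.re - e)) p := by fun_prop
  have n1 := hre.eventually (Ioo_mem_nhds (sub_one_lt e) (lt_add_one e))
  have n2 := him.eventually (Ioo_mem_nhds (a := 0) (b := 1) (by dsimp only; linarith)
    (by dsimp only; linarith))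
  have := (locAff_proj p.1).of_comp (Q' := verPolygon 1)
    (L' := fun p' : polygon => matAct !![1, 0; 3 / 2, 1] p'.1) (l' := 𝓝 p) f ?_ ?_ one_pos
    (d := ⟨0, -(3 / 2 * e)⟩) ?_
  · rwa [clamp_coe] at this
  · refine tendsto_nhdsWithin_iff.2 ⟨hfp ▸ hf.tendsto p, ?_⟩
    filter_upwards [n2] with p' h
    exact ⟨p'.2.1, h.1.le, h.2.le⟩
  · filter_upwards [n1, n2] with p' h h'
    exact verPolygon_near_edge he h.1.le h.2.le h'.1.le h'.2.le
  · refine Eventually.of_forall fun p' => ?_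
    rw [matAct_vertical]
    apply Complex.ext <;> simp [f]
    ring

theorem locAff_verPolygon {p : polygon} (h3 : p.1.re ≤ 3) (hp : verPolygon 1 p ∉ sing) :
    LocAff (verPolygon 1) (fun p' : polygon => matAct !![1, 0; 3 / 2, 1] p'.1) (𝓝 p)
      (verPolygon 1 p) := by
  by_cases he : p.1.re = 0 ∨ p.1.re = 1 ∨ p.1.re = 3
  · exact locAff_verPolygon_edge he hp
  push Not at he
  have h0 : 0 < p.1.re := p.2.1.1.lt_of_ne he.1.symm
  have hc : ContinuousAt (fun p' : polygon => p'.1.re) p := by fun_prop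
  have hm : Continuous fun p' : polygon => matAct !![1, 0; 3 / 2, 1] p'.1 :=
    (continuous_matAct _).comp continuous_subtype_val
  rcases lt_or_gt_of_ne he.2.1 with h1 | h1
  · have e : ∀ p' : polygon, p'.1.re ≤ 1 → verPolygon 1 p' =
        vline (matAct !![1, 0; 3 / 2, 1] p'.1).re (matAct !![1, 0; 3 / 2, 1] p'.1).im := by
      intro p' h
      rw [verPolygon_eq₁ 1 (by linarith), verHalf_eq₁ 1 h, matAct_vertical]
      dsimp only
      congr 1
      push_cast
      ring
    rw [e p h1.le]
    refine (locAff_vline (by rw [matAct_vertical]; exact ⟨h0, h1⟩)).of_comp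
      (fun p' => matAct !![1, 0; 3 / 2, 1] p'.1) hm.continuousAt ?_ one_pos (d := 0) (by simp)
    filter_upwards [hc.eventually (gt_mem_nhds h1)] with p' h using e p' (le_of_lt h)
  · have h3' : p.1.re < 3 := h3.lt_of_ne he.2.2
    -- Cylinder coordinates on the second piece are at half scale: the point `(x, y)` has
    -- coordinates `((x - 1) / 2, 1 + y / 2)`. The translation is what remains after halving the
    -- sheared point, with `1/4 = 1 - 3/4`.
    let f : polygon → ℂ := fun p' =>
      (1 / 2 : ℝ) * matAct !![1, 0; 3 / 2, 1] p'.1 + ⟨-(1 / 2), 1 / 4⟩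
    have hf : Continuous f := by fun_prop
    have f1 : ∀ p', (f p').re = (p'.1.re - 1) / 2 := by
      intro p'
      simp only [f, matAct_vertical, Complex.add_re, Complex.re_ofReal_mul]
      ring
    have f2 : ∀ p', (f p').im = 1 + p'.1.im / 2 + 3 / 2 * ((p'.1.re - 1) / 2) := by
      intro p'
      simp only [f, matAct_vertical, Complex.add_im, Complex.im_ofReal_mul]
      ring
    have e : ∀ p' : polygon, 1 ≤ p'.1.re → p'.1.re ≤ 3 →
        verPolygon 1 p' = vline (f p').re (f p').im := by
      intro p' h h'
      rw [verPolygon_eq₁ 1 h', verHalf_eq₂ 1 h, f1, f2, Int.cast_one, one_mul]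
    rw [e p h1.le h3]
    refine (locAff_vline (by rw [f1]; constructor <;> linarith)).of_comp f hf.continuousAt ?_
      one_half_pos (d := ⟨-(1 / 2), 1 / 4⟩) (Eventually.of_forall fun _ => rfl)
    filter_upwards [hc.eventually (Ioo_mem_nhds h1 h3')] with p' h using e p' h.1.le h.2.le

theorem ver_mem_veechGroup {M : Matrix.SpecialLinearGroup (Fin 2) ℝ}
    (hM : M.1 = !![1, 0; 3 / 2, 1]) : M ∈ discoSurface.veechGroup := by
  refine mem_veechGroup (f := ver 1) (image_sing_of_fixed fun p hp => verPolygon_edge 1 hp.2)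
    fun p hp => ?_
  simp only [ver_apply, hM] at hp ⊢
  rcases le_total p.1.re 3 with h | h
  · exact locAff_verPolygon h hp
  -- On the right half the twist is conjugate to the one on the left. The two sign changes cancel in
  -- the linear part and leave only a translation by the image of `6 + i`.
  · have e : ∀ p', verPolygon 1 p' = rotFun (verPolygon 1 (rotPolygon p')) := by
      intro p'; rw [verPolygon_rot, rotFun_rotFun]
    have hp' : verPolygon 1 (rotPolygon p) ∉ sing := by
      rw [verPolygon_rot]
      intro h
      obtain ⟨q, hq, h⟩ := h
      refine hp ⟨rotPolygon q, isVertex_rot.2 hq, ?_⟩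
      rw [← rotFun_proj, h, rotFun_rotFun]
    rw [e p]
    refine (locAff_verPolygon (by rw [rotPolygon_re]; linarith) hp').rot.of_comp rotPolygon
      continuous_rotPolygon.continuousAt (Eventually.of_forall e) one_pos
      (d := -matAct !![1, 0; 3 / 2, 1] (6 + Complex.I)) (Eventually.of_forall fun p' => ?_)
    simp only [matAct_vertical]
    apply Complex.ext <;> simp [rotPolygon_re, rotPolygon_im] <;> ring

end Disco

end

theorem mainTheorem10 : discoGamma ≤ discoSurface.veechGroup := by
  rw [discoGamma, Subgroup.closure_le]
  rintro M (rfl | rfl | rfl)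
  · exact Disco.hor_mem_veechGroup rfl
  · exact Disco.ver_mem_veechGroup rfl
  · exact Disco.rot_mem_veechGroup rfl
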